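/- **Setting.** An RBM with $n$ observed and $m$ latent variables, with interaction matrix $J\in\mathbb R^{n\times m}$ and external fields $h\in\mathbb R^n$, $g\in\mathbb R^m$, is the distribution $\Pr[X=x,Y=y]=\frac1Z\exp(x^TJy+h^Tx+g^Ty)$ on $\{\pm1\}^n\times\{\pm1\}^m$; only $X$ is observed. For $\alpha>0$ it is $(\alpha,\lambda)$-locally consistent if for each $j$ all $J_{ij}\ge 0$ or all $J_{ij}\le 0$; $|J_{ij}|\ge\alpha$ whenever $J_{ij}\ne0$; $\sum_j|J_{ij}|+|h_i|\le\lambda$ for all $i$; and $\sum_i|J_{ij}|+|g_j|\le\lambda$ for all $j$. The two-hop neighborhood of an observed node $u$ is $N_2(u)=\{i\ne u:\exists j,\ J_{ij}\ne0,\ J_{uj}\neq 0\}$. Let $\delta>0$ be any lower bound for all conditional probabilities $\Pr[X_i=x_i\mid X_k=x_k\ \forall k\ne i]$, $i\in[n]$, $x\in\{\pm1\}^n$. For samples $X^{(1)},\dots,X^{(M)}\in\{\pm1\}^n$, $u\ne v$ and $S\subseteq[n]\setminus\{u,v\}$, let $\widehat{\mathsf{Cov}}^{\mathsf{avg}}(u,v|S)=\hat{\mathbb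 E}_{x_S}\big[\hat{\mathbb E}[X_uX_v|X_S=x_S]-\hat{\mathbb E}[X_u|X_S=x_S]\,\hat{\mathbb E}[X_v|X_S=x_S]\big]$, all expectations being with respect to the empirical distribution. The algorithm $\mathrm{LearnRBMNbhd}(X^{(1)},\dots,X^{(M)},\tau,u)$ starts with $S=\emptyset$; as long as $\max_{v\notin S\cup\{u\}}\widehat{\mathsf{Cov}}^{\mathsf{avg}}(u,v|S)\ge\tau$, it adds a maximizer $v$ to $S$ (ties broken arbitrarily); when the maximum is below $\tau$ or no candidate is left, it goes in any order once through the elements $v$ of $S$, removing $v$ from the current set $S$ if $\widehat{\mathsf{Cov}}^{\mathsf{avg}}(u,v|S\setminus\{v\})<\tau$, and returns $S$. **Theorem 4.1.** There are universal constants $C,c>0$ such that the following holds. (1) Consider an $(\alpha,\lambda)$-locally consistent RBM with $\alpha>0$, and let $\tau=\frac{\alpha^2}{2}e^{-12\lambda}$, $T^*=8/\tau^2$ and $0<\zeta<1$. Then $\delta=\frac12e^{-2\lambda}$ is an admissible choice of $\delta$, and for every admissible $\delta$, if $$M\ \ge\ C\,\big(\log(1/\zeta)+T^*\log n\big)\,\frac{2^{2T^*}}{\tau^2\,\delta^{2T^*}}$$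 and $X^{(1)},\dots,X^{(M)}$ are i.i.d. samples of the observed variables $X$, then with probability at least $1-\zeta$, simultaneously for every observed node $u$ (and however ties are broken and the pruning is ordered), $\mathrm{LearnRBMNbhd}(X^{(1)},\dots,X^{(M)},\tau,u)$ outputs exactly $N_2(u)$. (2) $\mathrm{LearnRBMNbhd}$ runs in time $O(T^*Mn)$ for each node $u$: there is one program for the unit-cost real RAM (unit-cost addition, subtraction and comparison of natural numbers, indexed access, exact real arithmetic and comparison) that, for all $n$, all $M\ge1$, all samples in $\{\pm1\}^n$, all thresholds $\tau>0$ and all $u\in[n]$, computes an output of $\mathrm{LearnRBMNbhd}(X^{(1)},\dots,X^{(M)},\tau,u)$ in at most $c\cdot\max(1,T^*)\cdot M\cdot n$ steps, where $T^*=8/\tau^2$. -/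

import Mathlib

open Finset MeasureTheory ProbabilityTheory

namespace RBMLearn

/-! ### Restricted Boltzmann machines -/

/-- Configurations in `{±1}ᵏ`; `true` stands for `+1` and `false` for `-1`. -/
abbrev Config (k : ℕ) : Type := Fin k → Bool

/-- The numerical value of a spin. -/
def spin (b : Bool) : ℝ := if b then 1 else -1

/-- An RBM with `n` observed and `m` latent variables: interaction matrix `J`, external fields
`h` (observed) and `g` (latent). Its edges are the pairs `(i, j)` with `J i j ≠ 0`. -/
structure RBM (n m : ℕ) where
  J : Matrix (Fin n) (Fin m) ℝ
  h : Fin n → ℝ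
  g : Fin m → ℝ

namespace RBM

variable {n m : ℕ}

/-- The unnormalized weight `exp (xᵀ J y + hᵀ x + gᵀ y)`. -/
noncomputable def weight (R : RBM n m) (x : Config n) (y : Config m) : ℝ :=
  Real.exp ((∑ i, ∑ j, spin (x i) * R.J i j * spin (y j)) + (∑ i, R.h i * spin (x i))
    + ∑ j, R.g j * spin (y j))

/-- The partition function. -/
noncomputable def partition (R : RBM n m) : ℝ :=
  ∑ x : Config n, ∑ y : Config m, R.weight x y

/-- `Pr[X = x, Y = y]`. -/
noncomputable def prob (R : RBM n m) (x : Config n) (y : Config m) : ℝ :=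
  R.weight x y / R.partition

/-- `Pr[X = x]`, the law of the observed variables. -/
noncomputable def obsProb (R : RBM n m) (x : Config n) : ℝ :=
  ∑ y : Config m, R.prob x y

/-- `(α, lam)`-local consistency. -/
structure LocallyConsistent (R : RBM n m) (α lam : ℝ) : Prop where
  sign : ∀ j, (∀ i, 0 ≤ R.J i j) ∨ (∀ i, R.J i j ≤ 0)
  edge : ∀ i j, R.J i j ≠ 0 → α ≤ |R.J i j|
  obs : ∀ i, (∑ j, |R.J i j|) + |R.h i| ≤ lam
  lat : ∀ j, (∑ i, |R.J i j|) + |R.g j| ≤ lam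

/-- The two-hop neighborhood of the observed node `u`: the other observed nodes that share a
latent neighbor with `u`. -/
def IsTwoHop (R : RBM n m) (u i : Fin n) : Prop :=
  i ≠ u ∧ ∃ j, R.J i j ≠ 0 ∧ R.J u j ≠ 0

end RBM

/-! ### Conditional covariances of a probability mass function `p` on `{±1}ⁿ` -/

section Covariance

variable {n : ℕ}

/-- `x` and `z` agree on the coordinates in `S`. -/
def AgreeOn (S : Finset (Fin n)) (x z : Config n) : Prop := ∀ i ∈ S, z i = x i

instance (S : Finset (Fin n)) (x z : Config n) : Decidable (AgreeOn S x z) := by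
  unfold AgreeOn; infer_instance

/-- `Pr[X_S = x_S]`. -/
def margProb (p : Config n → ℝ) (S : Finset (Fin n)) (x : Config n) : ℝ :=
  ∑ z with AgreeOn S x z, p z

/-- `E[f(X) | X_S = x_S]`. (Only used with a weight that vanishes when `Pr[X_S = x_S] = 0`.) -/
noncomputable def condMean (p : Config n → ℝ) (S : Finset (Fin n)) (x : Config n)
    (f : Config n → ℝ) : ℝ :=
  (∑ z with AgreeOn S x z, p z * f z) / margProb p S x

/-- `Cov(u, v | X_S = x_S)`. -/
noncomputable def condCov (p : Config n → ℝ) (u v : Fin n) (S : Finset (Fin n))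
    (x : Config n) : ℝ :=
  condMean p S x (fun z => spin (z u) * spin (z v))
    - condMean p S x (fun z => spin (z u)) * condMean p S x (fun z => spin (z v))

/-- The average conditional covariance `Cov^avg(u, v | S)`, the expectation of
`Cov(u, v | X_S = x_S)` over `x ~ p`. -/
noncomputable def covAvg (p : Config n → ℝ) (u v : Fin n) (S : Finset (Fin n)) : ℝ :=
  ∑ x, p x * condCov p u v S x

/-- `δ > 0` is a lower bound for all conditional probabilities
`Pr[X_i = x_i | X_k = x_k for all k ≠ i]`. -/
def IsCondProbLowerBound (p : Config n → ℝ) (δ : ℝ) : Prop :=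
  0 < δ ∧ ∀ (i : Fin n) (x : Config n), δ ≤ p x / margProb p (univ.erase i) x

/-- The empirical distribution of the samples `X^(1), …, X^(M)`. -/
noncomputable def empirical {M : ℕ} (X : Fin M → Config n) (x : Config n) : ℝ :=
  (#{k | X k = x} : ℝ) / M

end Covariance

/-! ### The greedy algorithm -/

section Algorithm

variable {n M : ℕ}

/-- The empirical average conditional covariance. -/
noncomputable def empCovAvg (X : Fin M → Config n) (u v : Fin n) (S : Finset (Fin n)) : ℝ :=
  covAvg (empirical X) u v S

/-- `i` attains `max_v` of the empirical average conditional covariance of `u` and `v` given `S`,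
where `v` ranges over the observed nodes outside `S ∪ {u}`. -/
def IsArgmax (X : Fin M → Config n) (u : Fin n) (S : Finset (Fin n)) (i : Fin n) : Prop :=
  i ∉ insert u S ∧ ∀ v, v ∉ insert u S → empCovAvg X u v S ≤ empCovAvg X u i S

/-- `Grows X τ u S S'`: started from the current set `S`, the greedy phase can end with `S'`.
While the maximum is at least `τ`, a maximizer is added (ties are broken arbitrarily); when it is
below `τ`, or there is no candidate left, the phase stops. -/
inductive Grows (X : Fin M → Config n) (τ : ℝ) (u : Fin n) :
    Finset (Fin n) → Finset (Fin n) → Prop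
  | finish (S : Finset (Fin n)) (h : ∀ v, v ∉ insert u S → empCovAvg X u v S < τ) :
      Grows X τ u S S
  | step (S S' : Finset (Fin n)) (i : Fin n) (hi : IsArgmax X u S i)
      (hτ : τ ≤ empCovAvg X u i S) (h : Grows X τ u (insert i S) S') :
      Grows X τ u S S'

open Classical in
/-- One test of the pruning phase: `v` is removed if its empirical average conditional covariance
with `u` given the other nodes of the current set is below `τ`. -/
noncomputable def pruneStep (X : Fin M → Config n) (τ : ℝ) (u : Fin n) (S : Finset (Fin n))
    (v : Fin n) : Finset (Fin n) :=
  if empCovAvg X u v (S.erase v) < τ then S.erase v else S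

/-- `LearnRBMNbhd X τ u S`: the set `S` is an output of the greedy algorithm on the samples `X`,
with threshold `τ`, at the observed node `u`. The pruning loop visits each element of the set
built by the greedy phase once, in an arbitrary order `l`. -/
def LearnRBMNbhd (X : Fin M → Config n) (τ : ℝ) (u : Fin n) (S : Finset (Fin n)) : Prop :=
  ∃ (S₀ : Finset (Fin n)) (l : List (Fin n)), Grows X τ u ∅ S₀ ∧ l.Nodup ∧ l.toFinset = S₀ ∧
    S = l.foldl (pruneStep X τ u) S₀

end Algorithm

/-! ### Unit-cost real random access machine

Programs of a small imperative language over finitely many arrays of natural numbers (for indices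
and counters) and finitely many arrays of reals. All operations are exact and cost one unit:
addition, truncated subtraction and comparison of natural numbers, the four arithmetic operations
and comparison of reals, indexed access. The constants of a program are rational. -/

/-- The memory: array name, then index. -/
structure Memory where
  nat : ℕ → ℕ → ℕ
  real : ℕ → ℕ → ℝ

/-- Index expressions. -/
inductive NExpr
  | const (c : ℕ)
  | get (a : ℕ) (i : NExpr)
  | add (e f : NExpr)
  | sub (e f : NExpr)

/-- Real expressions. -/
inductive RExpr
  | const (c : ℚ)
  | get (a : ℕ) (i : NExpr)
  | add (e f : RExpr)
  | sub (e f : RExpr)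
  | mul (e f : RExpr)
  | div (e f : RExpr)

/-- Tests. -/
inductive Test
  | natLt (e f : NExpr)
  | natEq (e f : NExpr)
  | realLt (e f : RExpr)
  | realEq (e f : RExpr)

/-- Programs. -/
inductive Prog
  | skip
  | setNat (a : ℕ) (i e : NExpr)
  | setReal (a : ℕ) (i : NExpr) (e : RExpr)
  | seq (P Q : Prog)
  | ite (b : Test) (P Q : Prog)
  | loop (b : Test) (P : Prog)

def NExpr.eval (s : Memory) : NExpr → ℕ
  | .const c => c
  | .get a i => s.nat a (i.eval s)
  | .add e f => e.eval s + f.eval s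
  | .sub e f => e.eval s - f.eval s

def NExpr.cost : NExpr → ℕ
  | .const _ => 1
  | .get _ i => i.cost + 1
  | .add e f => e.cost + f.cost + 1
  | .sub e f => e.cost + f.cost + 1

noncomputable def RExpr.eval (s : Memory) : RExpr → ℝ
  | .const c => c
  | .get a i => s.real a (i.eval s)
  | .add e f => e.eval s + f.eval s
  | .sub e f => e.eval s - f.eval s
  | .mul e f => e.eval s * f.eval s
  | .div e f => e.eval s / f.eval s

def RExpr.cost : RExpr → ℕ
  | .const _ => 1
  | .get _ i => i.cost + 1
  | .add e f => e.cost + f.cost + 1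
  | .sub e f => e.cost + f.cost + 1
  | .mul e f => e.cost + f.cost + 1
  | .div e f => e.cost + f.cost + 1

def Test.holds (s : Memory) : Test → Prop
  | .natLt e f => e.eval s < f.eval s
  | .natEq e f => e.eval s = f.eval s
  | .realLt e f => e.eval s < f.eval s
  | .realEq e f => e.eval s = f.eval s

def Test.cost : Test → ℕ
  | .natLt e f => e.cost + f.cost + 1
  | .natEq e f => e.cost + f.cost + 1
  | .realLt e f => e.cost + f.cost + 1
  | .realEq e f => e.cost + f.cost + 1

def Memory.setNat (s : Memory) (a i v : ℕ) : Memory :=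
  { s with nat := Function.update s.nat a (Function.update (s.nat a) i v) }

noncomputable def Memory.setReal (s : Memory) (a i : ℕ) (v : ℝ) : Memory :=
  { s with real := Function.update s.real a (Function.update (s.real a) i v) }

/-- `Exec P s t s'`: started in memory `s`, the program `P` halts after exactly `t` unit-cost
steps in memory `s'`. -/
inductive Exec : Prog → Memory → ℕ → Memory → Prop
  | skip (s : Memory) : Exec .skip s 1 s
  | setNat (s : Memory) (a : ℕ) (i e : NExpr) :
      Exec (.setNat a i e) s (i.cost + e.cost + 1) (s.setNat a (i.eval s) (e.eval s))
  | setReal (s : Memory) (a : ℕ) (i : NExpr) (e : RExpr) :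
      Exec (.setReal a i e) s (i.cost + e.cost + 1) (s.setReal a (i.eval s) (e.eval s))
  | seq {P Q : Prog} {s s' s'' : Memory} {t t' : ℕ} (hP : Exec P s t s') (hQ : Exec Q s' t' s'') :
      Exec (.seq P Q) s (t + t') s''
  | iteTrue {b : Test} {P Q : Prog} {s s' : Memory} {t : ℕ} (hb : b.holds s)
      (hP : Exec P s t s') : Exec (.ite b P Q) s (b.cost + t) s'
  | iteFalse {b : Test} {P Q : Prog} {s s' : Memory} {t : ℕ} (hb : ¬ b.holds s)
      (hQ : Exec Q s t s') : Exec (.ite b P Q) s (b.cost + t) s'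
  | loopEnd {b : Test} {P : Prog} {s : Memory} (hb : ¬ b.holds s) :
      Exec (.loop b P) s b.cost s
  | loopStep {b : Test} {P : Prog} {s s' s'' : Memory} {t t' : ℕ} (hb : b.holds s)
      (hP : Exec P s t s') (hL : Exec (.loop b P) s' t' s'') :
      Exec (.loop b P) s (b.cost + t + t') s''

/-- The input: `n, M, u` in the first three cells of natural-number array `0`, the threshold in
the first cell of real array `0`, the `i`-th coordinate (`±1`) of the `k`-th sample in cell
`k * n + i` of real array `1` (all counted from `0`), and zeros everywhere else. -/
noncomputable def inputMemory {n M : ℕ} (X : Fin M → Config n) (τ : ℝ) (u : Fin n) : Memory where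
  nat a i := if a = 0 then (if i = 0 then n else if i = 1 then M else if i = 2 then u else 0) else 0
  real a i :=
    if a = 0 then (if i = 0 then τ else 0)
    else if a = 1 then
      (if h : i < M * n then
        spin (X (finProdFinEquiv.symm ⟨i, h⟩).1 (finProdFinEquiv.symm ⟨i, h⟩).2) else 0)
    else 0

/-- The output `S` is read off natural-number array `1`, as the indicator of `S`. -/
def Memory.Outputs {n : ℕ} (s : Memory) (S : Finset (Fin n)) : Prop :=
  ∀ i : Fin n, s.nat 1 i = if i ∈ S then 1 else 0

end RBMLearn

open RBMLearn

/-! The threshold `τ` separates two cases. If `v` is a two-hop neighbor of `u`, the average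
conditional covariance given any `S` that avoids both is at least `2τ`
(`RBM.LocallyConsistent.le_covAvg`). If `S` contains the whole two-hop neighborhood of `u` but not
`u`, it vanishes for every `v ≠ u` (`RBM.covAvg_eq_zero`). Once empirical and true values differ by
less than `τ` on all sets that can occur, the greedy phase cannot stop before it has collected the
neighborhood, and every pruning test is decided correctly (`learnRBMNbhd_iff`).

Lower bound: reversing latent spins makes the model ferromagnetic without changing the law of `X`.
Given `Y`, the spins `X_u` and `X_v` are independent with means `f` and `g`, the hyperbolic tangents
of their local fields. Let `s` be a common latent neighbor and `β = α exp(-2λ)`. Then `f - βs`, `g -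
βs` and `s` are increasing, so FKG for the joint law conditioned on `X_S` yields `Cov(f, g) ≥ β²
Var(s)`, and `Var(s) ≥ exp(-2λ)`.

Size of the sets: `E[X_u | X_S]` is an orthogonal projection, and adding a node with covariance at
least `τ` raises its second moment, which is at most `1`, by at least `τ²` (`explained_insert`). So
the greedy set has at most `1/τ² = T/8` elements.

Statistics: the average covariance is a sum over `2^|S|` cells of expressions that are Lipschitz in
the marginals, however small the cell (`abs_covAvg_sub_le`). Hoeffding's inequality and a union
bound over low-order marginals (`le_measureReal_margProb`) finish part (1).

Running time: the residual of `X_u` does not depend on the candidate `v`. One round computes it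
once, by splitting the samples into classes that agree on `S`, and then needs one inner product of
length `M` per candidate: `O(Mn)` in total. There are at most `1/τ² + 1` greedy rounds and at most
`1/τ²` pruning tests that compute a covariance (`learnProg_spec`). -/

namespace RBMLearn

/-! ### Conditional means as projections, and the energy increment. -/

section CondMean

variable {n : ℕ} {p : Config n → ℝ} {S : Finset (Fin n)}

lemma spin_mul_self (b : Bool) : spin b * spin b = 1 := by cases b <;> simp [spin]

lemma spin_not (b : Bool) : spin (!b) = -spin b := by cases b <;> simp [spin]

lemma abs_spin (b : Bool) : |spin b| = 1 := by cases b <;> simp [spin]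

lemma AgreeOn.refl (S : Finset (Fin n)) (x : Config n) : AgreeOn S x x := fun _ _ => rfl

lemma AgreeOn.symm {x z : Config n} (h : AgreeOn S x z) : AgreeOn S z x :=
  fun i hi => (h i hi).symm

lemma AgreeOn.trans {x y z : Config n} (h : AgreeOn S x y) (h' : AgreeOn S y z) :
    AgreeOn S x z := fun i hi => (h' i hi).trans (h i hi)

lemma filter_agreeOn_congr {x y : Config n} (h : AgreeOn S x y) :
    (univ.filter fun z => AgreeOn S x z) = univ.filter fun z => AgreeOn S y z := by
  ext z
  simp only [mem_filter, mem_univ, true_and]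
  exact ⟨fun hz => h.symm.trans hz, fun hz => h.trans hz⟩

lemma margProb_congr {x y : Config n} (h : AgreeOn S x y) : margProb p S x = margProb p S y := by
  unfold margProb
  rw [filter_agreeOn_congr h]

lemma condMean_congr {x y : Config n} (h : AgreeOn S x y) (f : Config n → ℝ) :
    condMean p S x f = condMean p S y f := by
  unfold condMean
  rw [filter_agreeOn_congr h, margProb_congr h]

lemma margProb_nonneg (hp : ∀ x, 0 ≤ p x) (S : Finset (Fin n)) (x : Config n) :
    0 ≤ margProb p S x := sum_nonneg fun z _ => hp z

lemma le_margProb (hp : ∀ x, 0 ≤ p x) (S : Finset (Fin n)) (x : Config n) :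
    p x ≤ margProb p S x :=
  single_le_sum (f := p) (fun z _ => hp z) (by simp [AgreeOn.refl])

/-- The conditional mean given `X_S` is the orthogonal projection onto the functions of `X_S`. -/
lemma sum_mul_condMean_mul (hp : ∀ x, 0 ≤ p x) (f g : Config n → ℝ)
    (hg : ∀ x y, AgreeOn S x y → g x = g y) :
    ∑ x, p x * (condMean p S x f * g x) = ∑ x, p x * (f x * g x) := by
  have h1 : ∀ x, p x * (condMean p S x f * g x)
      = ∑ z, if AgreeOn S x z then p x / margProb p S x * (p z * f z * g z) else 0 := by
    intro x
    unfold condMean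
    rw [← sum_filter, ← mul_sum, div_mul_eq_mul_div, sum_mul, ← mul_div_assoc, div_mul_eq_mul_div]
    congr 2
    refine sum_congr rfl fun z hz => ?_
    rw [hg x z (mem_filter.1 hz).2]
  -- The left side is a sum over pairs that agree on `S`. The weight `1 / margProb` depends only on
  -- the cell, so summing over `x` first cancels it.
  rw [sum_congr rfl fun x _ => h1 x, sum_comm]
  refine sum_congr rfl fun z _ => ?_
  have h2 : ∀ x, (if AgreeOn S x z then p x / margProb p S x * (p z * f z * g z) else 0)
      = if AgreeOn S z x then p x * (1 / margProb p S z * (p z * f z * g z)) else 0 := by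
    intro x
    by_cases h : AgreeOn S x z
    · rw [if_pos h, if_pos h.symm, margProb_congr h]; ring
    · rw [if_neg h, if_neg fun h' => h h'.symm]
  rw [sum_congr rfl fun x _ => h2 x, ← sum_filter, ← sum_mul]
  change margProb p S z * _ = _
  -- On a null cell the quotient is a junk value, but `p z = 0` there.
  by_cases h0 : margProb p S z = 0
  · have : p z = 0 := le_antisymm (h0 ▸ le_margProb hp S z) (hp z)
    simp [this]
  · field_simp

lemma sum_mul_condMean (hp : ∀ x, 0 ≤ p x) (f : Config n → ℝ) :
    ∑ x, p x * condMean p S x f = ∑ x, p x * f x := by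
  simpa using sum_mul_condMean_mul (S := S) hp f (fun _ => 1) (fun _ _ _ => rfl)

/-- The average conditional covariance is the correlation of `X_v` with the residual of `X_u`. -/
lemma covAvg_eq (hp : ∀ x, 0 ≤ p x) (u v : Fin n) :
    covAvg p u v S
      = ∑ x, p x * ((spin (x u) - condMean p S x fun z => spin (z u)) * spin (x v)) := by
  unfold covAvg condCov
  have h1 := sum_mul_condMean (S := S) hp fun z => spin (z u) * spin (z v)
  have h2 := sum_mul_condMean_mul (S := S) hp (fun z => spin (z v))
    (fun x => condMean p S x fun z => spin (z u)) fun x y h => condMean_congr h _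
  simp only [mul_sub, sub_mul, sum_sub_distrib, h1]
  congr 1
  calc _ = ∑ x, p x * ((condMean p S x fun z => spin (z v)) *
        condMean p S x fun z => spin (z u)) := sum_congr rfl fun x _ => by ring
    _ = _ := by rw [h2]; exact sum_congr rfl fun x _ => by ring

/-- The part of the second moment of `X_u` that is explained by `X_S`. -/
noncomputable def explained (p : Config n → ℝ) (u : Fin n) (S : Finset (Fin n)) : ℝ :=
  ∑ x, p x * (condMean p S x fun z => spin (z u)) ^ 2

lemma explained_nonneg (hp : ∀ x, 0 ≤ p x) (u : Fin n) (S : Finset (Fin n)) :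
    0 ≤ explained p u S := sum_nonneg fun x _ => mul_nonneg (hp x) (sq_nonneg _)

lemma abs_condMean_spin_le (hp : ∀ x, 0 ≤ p x) (u : Fin n) (S : Finset (Fin n)) (x : Config n) :
    |condMean p S x fun z => spin (z u)| ≤ 1 := by
  unfold condMean
  rw [abs_div, abs_of_nonneg (margProb_nonneg hp S x)]
  refine div_le_one_of_le₀ ((abs_sum_le_sum_abs _ _).trans_eq ?_) (margProb_nonneg hp S x)
  exact sum_congr rfl fun z _ => by rw [abs_mul, abs_spin, mul_one, abs_of_nonneg (hp z)]

lemma explained_le_one (hp : ∀ x, 0 ≤ p x) (h1 : ∑ x, p x = 1) (u : Fin n)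
    (S : Finset (Fin n)) : explained p u S ≤ 1 := by
  rw [← h1]
  refine sum_le_sum fun x _ => mul_le_of_le_one_right (hp x) ?_
  rw [sq_le_one_iff_abs_le_one]
  exact abs_condMean_spin_le hp u S x

/-- Pythagoras: with `m`, `m'` the projections of `X_u` for `S` and `insert v S`, the increment of
`explained` is the squared norm of `m' - m`. The covariance is the inner product of `m' - m` with
`X_v`, a function of norm one, so Cauchy–Schwarz applies. -/
lemma explained_insert (hp : ∀ x, 0 ≤ p x) (h1 : ∑ x, p x = 1) (u v : Fin n)
    (S : Finset (Fin n)) :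
    explained p u S + covAvg p u v S ^ 2 ≤ explained p u (insert v S) := by
  set m : Config n → ℝ := fun x => condMean p S x fun z => spin (z u) with hm
  set m' : Config n → ℝ := fun x => condMean p (insert v S) x fun z => spin (z u) with hm'
  have hmono : ∀ x y, AgreeOn (insert v S) x y → AgreeOn S x y :=
    fun x y h i hi => h i (mem_insert_of_mem hi)
  -- `X_v` is a function of the coordinates in `insert v S`, so `X_u` may be replaced by its
  -- projection `m'`.
  have e1 : covAvg p u v S = ∑ x, p x * ((m' x - m x) * spin (x v)) := by
    rw [covAvg_eq hp]
    have := sum_mul_condMean_mul (S := insert v S) hp (fun z => spin (z u))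
      (fun x => spin (x v)) fun x y h => by rw [h v (mem_insert_self _ _)]
    simp only [sub_mul, mul_sub, sum_sub_distrib] at *
    rw [← this]
  have e2 : ∑ x, p x * (m' x * m x) = ∑ x, p x * (m x * m x) := by
    rw [sum_mul_condMean_mul (S := insert v S) hp (fun z => spin (z u)) m
      fun x y h => condMean_congr (hmono x y h) _]
    exact (sum_mul_condMean_mul (S := S) hp (fun z => spin (z u)) m
      fun x y h => condMean_congr h _).symm
  have e3 : ∑ x, p x * (m' x - m x) ^ 2 = explained p u (insert v S) - explained p u S := by
    have : ∀ x, p x * (m' x - m x) ^ 2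
        = p x * m' x ^ 2 - p x * m x ^ 2 - 2 * (p x * (m' x * m x) - p x * (m x * m x)) :=
      fun x => by ring
    rw [sum_congr rfl fun x _ => this x, sum_sub_distrib, sum_sub_distrib, ← mul_sum,
      sum_sub_distrib, e2]
    simp [explained, hm, hm']
  have e4 : covAvg p u v S ^ 2 ≤ (∑ x, p x * (m' x - m x) ^ 2) * ∑ x, p x := by
    rw [e1]
    refine sum_sq_le_sum_mul_sum_of_sq_le_mul _ (fun x _ => mul_nonneg (hp x) (sq_nonneg _))
      (fun x _ => hp x) fun x _ => le_of_eq ?_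
    have := spin_mul_self (x v)
    linear_combination (p x) ^ 2 * (m' x - m x) ^ 2 * this
  rw [h1, mul_one, e3] at e4
  linarith

/-- The square is bounded by an increment of `explained`, which stays in `[0, 1]`. -/
lemma abs_covAvg_le_one (hp : ∀ x, 0 ≤ p x) (h1 : ∑ x, p x = 1) (u v : Fin n)
    (S : Finset (Fin n)) : |covAvg p u v S| ≤ 1 := by
  rw [← sq_le_one_iff_abs_le_one]
  linarith [explained_insert hp h1 u v S, explained_nonneg hp u S,
    explained_le_one hp h1 u (insert v S)]

end CondMean

/-! ### Empirical distribution and sample residuals. -/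

section Empirical

variable {n M : ℕ}

lemma empirical_nonneg (X : Fin M → Config n) (x : Config n) : 0 ≤ empirical X x := by
  unfold empirical; positivity

/-- Expectations with respect to the empirical distribution are sample averages. -/
lemma sum_empirical_mul (X : Fin M → Config n) (f : Config n → ℝ) :
    ∑ x, empirical X x * f x = (∑ k, f (X k)) / M := by
  unfold empirical
  simp only [div_mul_eq_mul_div, ← sum_div]
  congr 1
  rw [← sum_fiberwise univ X fun k => f (X k)]
  refine sum_congr rfl fun x _ => ?_
  rw [sum_congr rfl fun k hk => by rw [(mem_filter.1 hk).2], sum_const, nsmul_eq_mul]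

lemma sum_filter_empirical_mul (X : Fin M → Config n) (S : Finset (Fin n)) (x : Config n)
    (f : Config n → ℝ) :
    ∑ z with AgreeOn S x z, empirical X z * f z = (∑ k with AgreeOn S x (X k), f (X k)) / M := by
  have := sum_empirical_mul X fun z => if AgreeOn S x z then f z else 0
  simpa [mul_ite, ← sum_filter] using this

lemma margProb_empirical (X : Fin M → Config n) (S : Finset (Fin n)) (x : Config n) :
    margProb (empirical X) S x = (#{k | AgreeOn S x (X k)} : ℝ) / M := by
  simpa [margProb] using sum_filter_empirical_mul X S x fun _ => 1

lemma sum_empirical (hM : 0 < M) (X : Fin M → Config n) : ∑ x, empirical X x = 1 := by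
  have : (M : ℝ) ≠ 0 := by positivity
  simpa [this] using sum_empirical_mul X fun _ => 1

lemma condMean_empirical (hM : 0 < M) (X : Fin M → Config n) (S : Finset (Fin n)) (x : Config n)
    (f : Config n → ℝ) :
    condMean (empirical X) S x f
      = (∑ k with AgreeOn S x (X k), f (X k)) / (#{k | AgreeOn S x (X k)} : ℝ) := by
  have : (M : ℝ) ≠ 0 := by positivity
  rw [condMean, margProb_empirical, sum_filter_empirical_mul, div_div_div_cancel_right₀ this]

/-- The residual of `X_u` at the `k`-th sample, after regression on `X_S`. -/
noncomputable def residual (X : Fin M → Config n) (u : Fin n) (S : Finset (Fin n))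
    (k : Fin M) : ℝ :=
  spin (X k u) - (∑ l with AgreeOn S (X k) (X l), spin (X l u)) /
    (#{l | AgreeOn S (X k) (X l)} : ℝ)

/-- The residuals are free of `v`; this is what lets the program treat each candidate in `O(M)`
steps once they are known. -/
lemma empCovAvg_eq_residual (hM : 0 < M) (X : Fin M → Config n) (u v : Fin n)
    (S : Finset (Fin n)) :
    empCovAvg X u v S * M = ∑ k, spin (X k v) * residual X u S k := by
  have : (M : ℝ) ≠ 0 := by positivity
  rw [empCovAvg, covAvg_eq (empirical_nonneg X), sum_empirical_mul, div_mul_cancel₀ _ this]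
  refine sum_congr rfl fun k _ => ?_
  rw [condMean_empirical hM, residual, mul_comm]

end Empirical

/-! ### Quantitative bounds for the hyperbolic tangent. -/

section Tanh

lemma tanh_sub_tanh (a b : ℝ) :
    Real.tanh b - Real.tanh a = Real.sinh (b - a) / (Real.cosh a * Real.cosh b) := by
  have ha := (Real.cosh_pos a).ne'
  have hb := (Real.cosh_pos b).ne'
  rw [Real.tanh_eq_sinh_div_cosh, Real.tanh_eq_sinh_div_cosh, Real.sinh_sub]
  field_simp

lemma cosh_le_exp_of_abs_le {a l : ℝ} (h : |a| ≤ l) : Real.cosh a ≤ Real.exp l := by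
  rw [Real.cosh_eq]
  have h1 := Real.exp_le_exp.2 ((le_abs_self a).trans h)
  have h2 := Real.exp_le_exp.2 ((neg_le_abs a).trans h)
  linarith

/-- The difference equals `sinh (b - a) / (cosh a * cosh b)`; here `sinh x ≥ x` for `x ≥ 0`, and
each `cosh` is at most `exp l`. -/
lemma mul_exp_le_tanh_sub_tanh {a b l : ℝ} (ha : |a| ≤ l) (hb : |b| ≤ l) (hab : a ≤ b) :
    (b - a) * Real.exp (-2 * l) ≤ Real.tanh b - Real.tanh a := by
  rw [tanh_sub_tanh, le_div_iff₀ (mul_pos (Real.cosh_pos a) (Real.cosh_pos b))]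
  have h1 : Real.cosh a * Real.cosh b ≤ Real.exp l * Real.exp l :=
    mul_le_mul (cosh_le_exp_of_abs_le ha) (cosh_le_exp_of_abs_le hb) (Real.cosh_pos b).le
      (Real.exp_pos l).le
  have h2 : Real.exp (-2 * l) * (Real.exp l * Real.exp l) = 1 := by
    rw [← Real.exp_add, ← Real.exp_add, ← Real.exp_zero]; ring_nf
  calc (b - a) * Real.exp (-2 * l) * (Real.cosh a * Real.cosh b)
      ≤ (b - a) * Real.exp (-2 * l) * (Real.exp l * Real.exp l) :=
        mul_le_mul_of_nonneg_left h1 (mul_nonneg (sub_nonneg.2 hab) (Real.exp_pos _).le)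
    _ = b - a := by rw [mul_assoc, h2, mul_one]
    _ ≤ Real.sinh (b - a) := Real.self_le_sinh_iff.2 (sub_nonneg.2 hab)

lemma tanh_sq_le {a l : ℝ} (ha : |a| ≤ l) : Real.tanh a ^ 2 ≤ 1 - Real.exp (-2 * l) := by
  have hc := Real.cosh_pos a
  have h1 := cosh_le_exp_of_abs_le ha
  have h2 : Real.tanh a ^ 2 = 1 - 1 / Real.cosh a ^ 2 := by
    rw [Real.tanh_eq_sinh_div_cosh, div_pow, Real.sinh_sq]
    field_simp
  have h3 : Real.exp (-2 * l) = 1 / Real.exp l ^ 2 := by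
    rw [eq_div_iff (by positivity), ← Real.exp_nat_mul, ← Real.exp_add, ← Real.exp_zero]
    congr 1; push_cast; ring
  rw [h2, h3]
  have := one_div_le_one_div_of_le (by positivity) (pow_le_pow_left₀ hc.le h1 2)
  linarith

end Tanh

/-! ### Integrating out one spin by pairing configurations. -/

section Involution

variable {A : Type*} [Fintype A]

lemma sum_eq_zero_of_involutive {σ : A → A} (hσ : Function.Involutive σ) {G : A → ℝ}
    (hG : ∀ a, G (σ a) = -G a) : ∑ a, G a = 0 := by
  have h := Equiv.sum_comp hσ.toPerm G
  simp only [Function.Involutive.coe_toPerm, hG, sum_neg_distrib] at h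
  linarith

/-- A spin `s` with local field `F` may be replaced by its conditional mean `tanh F`. -/
lemma sum_mul_spin_eq_sum_mul_tanh {σ : A → A} (hσ : Function.Involutive σ) {w s F φ : A → ℝ}
    (hw : ∀ a, w (σ a) = w a * Real.exp (-2 * (s a * F a))) (hs : ∀ a, s (σ a) = -s a)
    (hs1 : ∀ a, s a = 1 ∨ s a = -1) (hF : ∀ a, F (σ a) = F a) (hφ : ∀ a, φ (σ a) = φ a) :
    ∑ a, w a * (s a * φ a) = ∑ a, w a * (Real.tanh (F a) * φ a) := by
  rw [← sub_eq_zero, ← sum_sub_distrib]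
  refine sum_eq_zero_of_involutive hσ fun a => ?_
  rw [hw, hs, hF, hφ]
  have hp := Real.exp_pos (F a)
  have hq := Real.exp_pos (-F a)
  have hpq : Real.exp (F a) * Real.exp (-F a) = 1 := by rw [← Real.exp_add]; simp
  have ht : Real.tanh (F a) = (Real.exp (F a) - Real.exp (-F a)) /
      (Real.exp (F a) + Real.exp (-F a)) := by
    rw [Real.tanh_eq_sinh_div_cosh, Real.sinh_eq, Real.cosh_eq]; field_simp
  -- This identity makes the contributions of `a` and `σ a` to the difference of the two sums
  -- cancel.
  have key : Real.exp (-2 * (s a * F a)) * (s a + Real.tanh (F a)) = s a - Real.tanh (F a) := by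
    rw [ht]
    rcases hs1 a with h | h
    · have e : Real.exp (-2 * (s a * F a)) = Real.exp (-F a) * Real.exp (-F a) := by
        rw [h, ← Real.exp_add]; ring_nf
      rw [e, h]
      field_simp
      linear_combination 2 * Real.exp (-F a) * hpq
    · have e : Real.exp (-2 * (s a * F a)) = Real.exp (F a) * Real.exp (F a) := by
        rw [h, ← Real.exp_add]; ring_nf
      rw [e, h]
      field_simp
      linear_combination -2 * Real.exp (F a) * hpq
  linear_combination (-(w a * φ a)) * key

end Involution

/-! ### The FKG inequality. -/

section FKG

variable {A : Type*} [DistribLattice A] [Fintype A]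

/-- The FKG inequality for monotone functions of arbitrary sign. -/
lemma fkg_of_monotone {w f g : A → ℝ} (hw : 0 ≤ w) (hf : Monotone f) (hg : Monotone g)
    (h : ∀ a b, w a * w b ≤ w (a ⊓ b) * w (a ⊔ b)) :
    (∑ a, w a * f a) * ∑ a, w a * g a ≤ (∑ a, w a) * ∑ a, w a * (f a * g a) := by
  -- `fkg` is stated for nonnegative functions. Adding constants changes neither monotonicity nor
  -- the covariance.
  obtain ⟨c, hc⟩ : ∃ c : ℝ, ∀ a, 0 ≤ f a + c :=
    ⟨∑ a, |f a|, fun a => by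
      have := single_le_sum (f := fun a => |f a|) (fun _ _ => abs_nonneg _) (mem_univ a)
      have := neg_abs_le (f a)
      linarith⟩
  obtain ⟨d, hd⟩ : ∃ d : ℝ, ∀ a, 0 ≤ g a + d :=
    ⟨∑ a, |g a|, fun a => by
      have := single_le_sum (f := fun a => |g a|) (fun _ _ => abs_nonneg _) (mem_univ a)
      have := neg_abs_le (g a)
      linarith⟩
  have := fkg (μ := w) (f := fun a => f a + c) (g := fun a => g a + d) hw hc hd
    (fun a b hab => by simpa using hf hab) (fun a b hab => by simpa using hg hab) h
  have e1 : ∑ a, w a * (f a + c) = ∑ a, w a * f a + c * ∑ a, w a := by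
    rw [mul_sum, ← sum_add_distrib]; exact sum_congr rfl fun a _ => by ring
  have e2 : ∑ a, w a * (g a + d) = ∑ a, w a * g a + d * ∑ a, w a := by
    rw [mul_sum, ← sum_add_distrib]; exact sum_congr rfl fun a _ => by ring
  have e3 : ∑ a, w a * ((f a + c) * (g a + d)) = ∑ a, w a * (f a * g a) + d * ∑ a, w a * f a
      + c * ∑ a, w a * g a + c * d * ∑ a, w a := by
    rw [mul_sum, mul_sum, mul_sum, ← sum_add_distrib, ← sum_add_distrib, ← sum_add_distrib]
    exact sum_congr rfl fun a _ => by ring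
  rw [e1, e2, e3] at this
  nlinarith

end FKG

/-! ### Reversing a single spin. -/

section Flip

variable {k : ℕ}

/-- The configuration with the `i`-th spin reversed. -/
def flipAt (i : Fin k) (x : Config k) : Config k := Function.update x i (!x i)

lemma flipAt_involutive (i : Fin k) : Function.Involutive (flipAt i) := fun x => by
  simp [flipAt]

lemma flipAt_self (i : Fin k) (x : Config k) : flipAt i x i = !x i := by simp [flipAt]

lemma flipAt_of_ne {i j : Fin k} (h : j ≠ i) (x : Config k) : flipAt i x j = x j := by
  simp [flipAt, h]

lemma sum_spin_flip (i : Fin k) (x : Config k) (F : Fin k → ℝ) :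
    ∑ j, spin (flipAt i x j) * F j = ∑ j, spin (x j) * F j - 2 * (spin (x i) * F i) := by
  rw [← add_sum_erase univ (fun j => spin (flipAt i x j) * F j) (mem_univ i),
    ← add_sum_erase univ (fun j => spin (x j) * F j) (mem_univ i), flipAt_self, spin_not,
    sum_congr rfl fun j hj => by rw [flipAt_of_ne (ne_of_mem_erase hj)]]
  ring

lemma agreeOn_flipAt {S : Finset (Fin k)} {i : Fin k} (hi : i ∉ S) (x z : Config k) :
    AgreeOn S x (flipAt i z) ↔ AgreeOn S x z :=
  forall₂_congr fun j hj => by rw [flipAt_of_ne (ne_of_mem_of_not_mem hj hi)]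

lemma agreeOn_erase_iff (i : Fin k) (x z : Config k) :
    AgreeOn (univ.erase i) x z ↔ z = x ∨ z = flipAt i x := by
  constructor
  · intro h
    have h' : ∀ j, j ≠ i → z j = x j := fun j hj => h j (by simp [hj])
    by_cases hz : z i = x i
    · left; ext j; by_cases hj : j = i
      · rw [hj, hz]
      · rw [h' j hj]
    · right; ext j; by_cases hj : j = i
      · rw [hj, flipAt_self]; cases h1 : z i <;> cases h2 : x i <;> simp_all
      · rw [h' j hj, flipAt_of_ne hj]
  · rintro (rfl | rfl) j hj
    · rfl
    · exact flipAt_of_ne (ne_of_mem_erase hj) x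

lemma margProb_erase (p : Config k → ℝ) (i : Fin k) (x : Config k) :
    margProb p (univ.erase i) x = p x + p (flipAt i x) := by
  have hne : x ≠ flipAt i x := fun h => by
    have := congrFun h i
    rw [flipAt_self] at this
    cases hx : x i <;> simp [hx] at this
  rw [margProb, ← sum_pair hne]
  refine sum_congr ?_ fun _ _ => rfl
  ext z
  simp [agreeOn_erase_iff]

end Flip

/-! ### Local fields and the admissible value of `δ`. -/

namespace RBM

variable {n m : ℕ} (R : RBM n m)

/-- The local field at an observed node. -/
def obsField (y : Config m) (i : Fin n) : ℝ := R.h i + ∑ j, R.J i j * spin (y j)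

/-- The local field at a latent node. -/
def latField (x : Config n) (j : Fin m) : ℝ := R.g j + ∑ i, R.J i j * spin (x i)

lemma weight_eq_obsField (x : Config n) (y : Config m) :
    R.weight x y
      = Real.exp (∑ i, spin (x i) * R.obsField y i + ∑ j, R.g j * spin (y j)) := by
  unfold weight obsField
  congr 2
  rw [← sum_add_distrib]
  refine sum_congr rfl fun i _ => ?_
  rw [mul_add, mul_sum, add_comm, mul_comm (R.h i)]
  congr 1
  exact sum_congr rfl fun j _ => by ring

lemma weight_eq_latField (x : Config n) (y : Config m) :
    R.weight x y
      = Real.exp (∑ j, spin (y j) * R.latField x j + ∑ i, R.h i * spin (x i)) := by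
  unfold weight latField
  congr 1
  simp only [mul_add, sum_add_distrib, mul_sum]
  rw [sum_comm, add_right_comm, add_comm (∑ j, _ * R.g j)]
  congr 2
  · exact sum_congr rfl fun j _ => sum_congr rfl fun i _ => by ring
  · exact sum_congr rfl fun j _ => by ring

lemma weight_flip_obs (u : Fin n) (x : Config n) (y : Config m) :
    R.weight (flipAt u x) y
      = R.weight x y * Real.exp (-2 * (spin (x u) * R.obsField y u)) := by
  rw [weight_eq_obsField, weight_eq_obsField, ← Real.exp_add, sum_spin_flip]
  congr 1; ring

lemma weight_flip_lat (j : Fin m) (x : Config n) (y : Config m) :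
    R.weight x (flipAt j y)
      = R.weight x y * Real.exp (-2 * (spin (y j) * R.latField x j)) := by
  rw [weight_eq_latField, weight_eq_latField, ← Real.exp_add, sum_spin_flip]
  congr 1; ring

lemma weight_pos (x : Config n) (y : Config m) : 0 < R.weight x y := Real.exp_pos _

lemma partition_pos : 0 < R.partition :=
  sum_pos (fun _ _ => sum_pos (fun _ _ => R.weight_pos _ _) univ_nonempty) univ_nonempty

lemma obsProb_eq (x : Config n) : R.obsProb x = (∑ y, R.weight x y) / R.partition := by
  simp only [obsProb, prob, sum_div]

lemma obsProb_pos (x : Config n) : 0 < R.obsProb x := by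
  rw [obsProb_eq]
  exact div_pos (sum_pos (fun _ _ => R.weight_pos _ _) univ_nonempty) R.partition_pos

lemma obsProb_nonneg (x : Config n) : 0 ≤ R.obsProb x := (R.obsProb_pos x).le

lemma sum_obsProb : ∑ x, R.obsProb x = 1 := by
  simp only [obsProb_eq, ← sum_div]
  exact div_self R.partition_pos.ne'

lemma margProb_obsProb_pos (S : Finset (Fin n)) (x : Config n) :
    0 < margProb R.obsProb S x :=
  (R.obsProb_pos x).trans_le (le_margProb R.obsProb_nonneg S x)

variable {R} {α lam : ℝ}

lemma LocallyConsistent.abs_obsField_le (hR : R.LocallyConsistent α lam) (y : Config m)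
    (i : Fin n) : |R.obsField y i| ≤ lam := by
  refine le_trans ?_ (hR.obs i)
  rw [obsField, add_comm]
  refine (abs_add_le _ _).trans (add_le_add_left ((abs_sum_le_sum_abs _ _).trans_eq ?_) _)
  exact sum_congr rfl fun j _ => by rw [abs_mul, abs_spin, mul_one]

lemma LocallyConsistent.abs_latField_le (hR : R.LocallyConsistent α lam) (x : Config n)
    (j : Fin m) : |R.latField x j| ≤ lam := by
  refine le_trans ?_ (hR.lat j)
  rw [latField, add_comm]
  refine (abs_add_le _ _).trans (add_le_add_left ((abs_sum_le_sum_abs _ _).trans_eq ?_) _)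
  exact sum_congr rfl fun j _ => by rw [abs_mul, abs_spin, mul_one]

lemma LocallyConsistent.nonneg (hR : R.LocallyConsistent α lam) (i : Fin n) : 0 ≤ lam :=
  (abs_nonneg _).trans (hR.abs_obsField_le (fun _ => true) i)

/-- Reversing the spin at an observed node changes its probability by a bounded factor. -/
lemma LocallyConsistent.obsProb_flip_le (hR : R.LocallyConsistent α lam) (i : Fin n)
    (x : Config n) : R.obsProb (flipAt i x) ≤ Real.exp (2 * lam) * R.obsProb x := by
  rw [obsProb_eq, obsProb_eq, ← mul_div_assoc]
  refine div_le_div_of_nonneg_right ?_ R.partition_pos.le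
  rw [mul_sum]
  refine sum_le_sum fun y _ => ?_
  rw [weight_flip_obs, mul_comm]
  refine mul_le_mul_of_nonneg_right (Real.exp_le_exp.2 ?_) (R.weight_pos x y).le
  have h1 : |spin (x i) * R.obsField y i| ≤ lam := by
    rw [abs_mul, abs_spin, one_mul]; exact hR.abs_obsField_le y i
  linarith [neg_le_of_abs_le h1]

/-- A flip multiplies the probability by at most `exp (2λ)`, so the conditional probability is at
least `1 / (1 + exp (2λ))`, and `λ ≥ 0` turns this into the stated bound. -/
lemma LocallyConsistent.isCondProbLowerBound (hR : R.LocallyConsistent α lam) :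
    IsCondProbLowerBound R.obsProb (Real.exp (-2 * lam) / 2) := by
  refine ⟨by positivity, fun i x => ?_⟩
  have h0 := hR.nonneg i
  have h1 := hR.obsProb_flip_le i x
  have hp := R.obsProb_pos x
  rw [le_div_iff₀ (R.margProb_obsProb_pos _ x), margProb_erase]
  have h2 : Real.exp (-2 * lam) * Real.exp (2 * lam) = 1 := by
    rw [← Real.exp_add, ← Real.exp_zero]; ring_nf
  have h3 : Real.exp (-2 * lam) ≤ 1 := Real.exp_le_one_iff.2 (by linarith)
  have h4 := mul_le_mul_of_nonneg_left h1 (Real.exp_pos (-2 * lam)).le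
  rw [← mul_assoc, h2, one_mul] at h4
  have h5 := mul_le_mul_of_nonneg_right h3 hp.le
  linarith

end RBM

/-! ### Covariance lower bound for ferromagnetic models. -/

namespace RBM

variable {n m : ℕ} {R : RBM n m} {α lam : ℝ}

section Ferromagnetic

/-- The weight restricted to the configurations that agree with `x₀` on `S`. -/
noncomputable def restrictedWeight (R : RBM n m) (S : Finset (Fin n)) (x₀ : Config n)
    (a : Config n × Config m) : ℝ :=
  if AgreeOn S x₀ a.1 then R.weight a.1 a.2 else 0

lemma restrictedWeight_nonneg (S : Finset (Fin n)) (x₀ : Config n) :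
    0 ≤ R.restrictedWeight S x₀ := fun a => by
  unfold restrictedWeight
  split_ifs
  exacts [(R.weight_pos _ _).le, le_rfl]

lemma sum_restrictedWeight_pos (R : RBM n m) (S : Finset (Fin n)) (x₀ : Config n) :
    0 < ∑ a, R.restrictedWeight S x₀ a :=
  sum_pos' (fun a _ => restrictedWeight_nonneg S x₀ a) ⟨(x₀, fun _ => true), mem_univ _, by
    rw [restrictedWeight, if_pos (AgreeOn.refl S x₀)]; exact R.weight_pos _ _⟩

lemma sum_obsProb_mul (S : Finset (Fin n)) (x₀ : Config n) (f : Config n → ℝ) :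
    ∑ z with AgreeOn S x₀ z, R.obsProb z * f z
      = (∑ a, R.restrictedWeight S x₀ a * f a.1) / R.partition := by
  rw [Fintype.sum_prod_type, sum_div, sum_filter]
  refine sum_congr rfl fun z _ => ?_
  simp only [restrictedWeight]
  split_ifs
  · rw [obsProb_eq, ← sum_mul]; ring
  · simp

/-- Passage to the joint law of observed and latent spins, on which the lattice condition holds. -/
lemma condMean_obsProb (S : Finset (Fin n)) (x₀ : Config n) (f : Config n → ℝ) :
    condMean R.obsProb S x₀ f = (∑ a, R.restrictedWeight S x₀ a * f a.1) /
      ∑ a, R.restrictedWeight S x₀ a := by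
  have h := sum_obsProb_mul (R := R) S x₀ fun _ => 1
  simp only [mul_one] at h
  rw [condMean, margProb, sum_obsProb_mul, h, div_div_div_cancel_right₀ R.partition_pos.ne']

lemma spin_inf_add_spin_sup (a b : Bool) : spin (a ⊓ b) + spin (a ⊔ b) = spin a + spin b := by
  cases a <;> cases b <;> simp [spin]

lemma spin_mul_spin_add_le (a b a' b' : Bool) :
    spin a * spin b + spin a' * spin b'
      ≤ spin (a ⊓ a') * spin (b ⊓ b') + spin (a ⊔ a') * spin (b ⊔ b') := by
  cases a <;> cases b <;> cases a' <;> cases b' <;> simp [spin] <;> norm_num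

lemma spin_mono : Monotone spin := fun a b h => by
  revert h
  cases a <;> cases b <;> simp [spin]

/-- In the exponent the field terms are modular, and the interaction terms with nonnegative
coefficients are supermodular. -/
lemma weight_mul_weight_le (hJ : ∀ i j, 0 ≤ R.J i j) (a b : Config n × Config m) :
    R.weight a.1 a.2 * R.weight b.1 b.2
      ≤ R.weight (a ⊓ b).1 (a ⊓ b).2 * R.weight (a ⊔ b).1 (a ⊔ b).2 := by
  simp only [weight, ← Real.exp_add, Real.exp_le_exp]
  have h1 : (∑ i, R.h i * spin ((a ⊓ b).1 i)) + ∑ i, R.h i * spin ((a ⊔ b).1 i)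
      = (∑ i, R.h i * spin (a.1 i)) + ∑ i, R.h i * spin (b.1 i) := by
    rw [← sum_add_distrib, ← sum_add_distrib]
    refine sum_congr rfl fun i _ => ?_
    rw [← mul_add, ← mul_add]
    exact congrArg _ (spin_inf_add_spin_sup _ _)
  have h2 : (∑ j, R.g j * spin ((a ⊓ b).2 j)) + ∑ j, R.g j * spin ((a ⊔ b).2 j)
      = (∑ j, R.g j * spin (a.2 j)) + ∑ j, R.g j * spin (b.2 j) := by
    rw [← sum_add_distrib, ← sum_add_distrib]
    refine sum_congr rfl fun i _ => ?_
    rw [← mul_add, ← mul_add]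
    exact congrArg _ (spin_inf_add_spin_sup _ _)
  have h3 : (∑ i, ∑ j, spin (a.1 i) * R.J i j * spin (a.2 j))
        + (∑ i, ∑ j, spin (b.1 i) * R.J i j * spin (b.2 j))
      ≤ (∑ i, ∑ j, spin ((a ⊓ b).1 i) * R.J i j * spin ((a ⊓ b).2 j))
        + ∑ i, ∑ j, spin ((a ⊔ b).1 i) * R.J i j * spin ((a ⊔ b).2 j) := by
    simp only [← sum_add_distrib]
    refine sum_le_sum fun i _ => sum_le_sum fun j _ => ?_
    have := mul_le_mul_of_nonneg_left
      (spin_mul_spin_add_le (a.1 i) (a.2 j) (b.1 i) (b.2 j)) (hJ i j)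
    calc _ = R.J i j * (spin (a.1 i) * spin (a.2 j) + spin (b.1 i) * spin (b.2 j)) := by ring
      _ ≤ _ := this
      _ = spin (a.1 i ⊓ b.1 i) * R.J i j * spin (a.2 j ⊓ b.2 j)
          + spin (a.1 i ⊔ b.1 i) * R.J i j * spin (a.2 j ⊔ b.2 j) := by ring
  linarith

/-- Conditioning on `X_S` keeps the lattice condition because the configurations that agree with
`x₀` on `S` form a sublattice. -/
lemma restrictedWeight_mul_le (hJ : ∀ i j, 0 ≤ R.J i j) (S : Finset (Fin n)) (x₀ : Config n)
    (a b : Config n × Config m) :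
    R.restrictedWeight S x₀ a * R.restrictedWeight S x₀ b
      ≤ R.restrictedWeight S x₀ (a ⊓ b) * R.restrictedWeight S x₀ (a ⊔ b) := by
  by_cases h : AgreeOn S x₀ a.1 ∧ AgreeOn S x₀ b.1
  · have h1 : AgreeOn S x₀ (a ⊓ b).1 := fun i hi => by
      change a.1 i ⊓ b.1 i = _
      rw [h.1 i hi, h.2 i hi, inf_idem]
    have h2 : AgreeOn S x₀ (a ⊔ b).1 := fun i hi => by
      change a.1 i ⊔ b.1 i = _
      rw [h.1 i hi, h.2 i hi, sup_idem]
    simp only [restrictedWeight, if_pos h.1, if_pos h.2, if_pos h1, if_pos h2]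
    exact weight_mul_weight_le hJ a b
  · refine le_trans (le_of_eq ?_)
      (mul_nonneg (restrictedWeight_nonneg S x₀ _) (restrictedWeight_nonneg S x₀ _))
    rcases not_and_or.1 h with h | h <;> simp [restrictedWeight, h]

/-- An observed spin outside `S` may be replaced by its conditional mean given the latent
spins. -/
lemma sum_restrictedWeight_obs {S : Finset (Fin n)} (x₀ : Config n) {u : Fin n} (hu : u ∉ S)
    {φ : Config n × Config m → ℝ} (hφ : ∀ x y, φ (flipAt u x, y) = φ (x, y)) :
    ∑ a, R.restrictedWeight S x₀ a * (spin (a.1 u) * φ a)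
      = ∑ a, R.restrictedWeight S x₀ a * (Real.tanh (R.obsField a.2 u) * φ a) := by
  refine sum_mul_spin_eq_sum_mul_tanh (σ := fun a => (flipAt u a.1, a.2))
    (fun a => by simp [flipAt_involutive u a.1]) (F := fun a => R.obsField a.2 u)
    (s := fun a => spin (a.1 u)) (fun a => ?_)
    (fun a => by simp only [flipAt_self, spin_not])
    (fun a => by cases h : a.1 u <;> simp [spin]) (fun _ => rfl) fun a => hφ a.1 a.2
  simp only [restrictedWeight, agreeOn_flipAt hu, weight_flip_obs]
  split_ifs <;> simp

lemma sum_restrictedWeight_lat (S : Finset (Fin n)) (x₀ : Config n) (j : Fin m) :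
    ∑ a, R.restrictedWeight S x₀ a * spin (a.2 j)
      = ∑ a, R.restrictedWeight S x₀ a * Real.tanh (R.latField a.1 j) := by
  have := sum_mul_spin_eq_sum_mul_tanh (σ := fun a : Config n × Config m => (a.1, flipAt j a.2))
    (fun a => by simp [flipAt_involutive j a.2]) (F := fun a => R.latField a.1 j)
    (w := R.restrictedWeight S x₀) (s := fun a => spin (a.2 j)) (φ := fun _ => 1) (fun a => ?_)
    (fun a => by simp only [flipAt_self, spin_not])
    (fun a => by cases h : a.2 j <;> simp [spin]) (fun _ => rfl) fun a => rfl
  · simpa using this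
  · simp only [restrictedWeight, weight_flip_lat]
    split_ifs <;> simp

/-- The conditional mean of an observed spin responds at least linearly to an adjacent latent
spin. -/
lemma LocallyConsistent.monotone_tanh_obsField_sub (hR : R.LocallyConsistent α lam) (hα : 0 < α)
    (hJ : ∀ i j, 0 ≤ R.J i j) {u : Fin n} {j : Fin m} (hu : R.J u j ≠ 0) :
    Monotone fun y : Config m =>
      Real.tanh (R.obsField y u) - α * Real.exp (-2 * lam) * spin (y j) := by
  intro y y' h
  have hsp : ∀ l, spin (y l) ≤ spin (y' l) := fun l => spin_mono (h l)
  have hα' : α ≤ R.J u j := by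
    have := hR.edge u j hu
    rwa [abs_of_nonneg (hJ u j)] at this
  -- All terms of the increment of the field are nonnegative; the term of `j` alone gives the bound.
  have hF : α * (spin (y' j) - spin (y j)) ≤ R.obsField y' u - R.obsField y u := by
    have e : R.obsField y' u - R.obsField y u
        = ∑ l, R.J u l * (spin (y' l) - spin (y l)) := by
      simp only [obsField, mul_sub, sum_sub_distrib]; ring
    rw [e]
    exact (mul_le_mul_of_nonneg_right hα' (sub_nonneg.2 (hsp j))).trans
      (single_le_sum (f := fun l => R.J u l * (spin (y' l) - spin (y l)))
        (fun l _ => mul_nonneg (hJ u l) (sub_nonneg.2 (hsp l))) (mem_univ j))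
  have h0 : 0 ≤ α * (spin (y' j) - spin (y j)) :=
    mul_nonneg hα.le (sub_nonneg.2 (hsp j))
  have ht := mul_exp_le_tanh_sub_tanh (hR.abs_obsField_le y u) (hR.abs_obsField_le y' u)
    (by linarith)
  have := mul_le_mul_of_nonneg_right hF (Real.exp_pos (-2 * lam)).le
  simp only
  linarith

/-- Expanding `f = (f - βs) + βs` and `g` likewise, `Cov(f, g)` is `β² Var(s)` plus three
covariances of increasing functions, which FKG makes nonnegative. -/
lemma LocallyConsistent.le_condCov_of_nonneg (hR : R.LocallyConsistent α lam) (hα : 0 < α)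
    (hJ : ∀ i j, 0 ≤ R.J i j) {u v : Fin n} {j : Fin m} (huv : u ≠ v) (hu : R.J u j ≠ 0)
    (hv : R.J v j ≠ 0) {S : Finset (Fin n)} (huS : u ∉ S) (hvS : v ∉ S) (x₀ : Config n) :
    α ^ 2 * Real.exp (-6 * lam) ≤ condCov R.obsProb u v S x₀ := by
  set w := R.restrictedWeight S x₀ with hw
  set N := ∑ a, w a with hN
  have hNpos : 0 < N := R.sum_restrictedWeight_pos S x₀
  set β := α * Real.exp (-2 * lam) with hβ
  have hβ0 : 0 ≤ β := by positivity
  set f : Config n × Config m → ℝ := fun a => Real.tanh (R.obsField a.2 u)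
  set g : Config n × Config m → ℝ := fun a => Real.tanh (R.obsField a.2 v)
  set s : Config n × Config m → ℝ := fun a => spin (a.2 j)
  have hfm : Monotone fun a => f a - β * s a := fun a b hab =>
    hR.monotone_tanh_obsField_sub hα hJ hu hab.2
  have hgm : Monotone fun a => g a - β * s a := fun a b hab =>
    hR.monotone_tanh_obsField_sub hα hJ hv hab.2
  have hsm : Monotone s := fun a b hab => spin_mono (hab.2 j)
  have hw0 : 0 ≤ w := restrictedWeight_nonneg S x₀
  have hlat := restrictedWeight_mul_le hJ S x₀
  -- Conditional independence given the latent spins: `X_u` is integrated out first, with `X_v` as a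
  -- factor that the flip at `u` leaves alone, and then `X_v`.
  have e1 : ∑ a, w a * (spin (a.1 u) * spin (a.1 v)) = ∑ a, w a * (f a * g a) := by
    rw [sum_restrictedWeight_obs x₀ huS (φ := fun a => spin (a.1 v))
      fun x y => by simp only [flipAt_of_ne huv.symm]]
    have := sum_restrictedWeight_obs (R := R) x₀ hvS (φ := f) fun x y => rfl
    calc _ = ∑ a, w a * (spin (a.1 v) * f a) := sum_congr rfl fun a _ => by ring
      _ = _ := this
      _ = _ := sum_congr rfl fun a _ => by ring
  have e2 : ∑ a, w a * spin (a.1 u) = ∑ a, w a * f a := by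
    simpa using sum_restrictedWeight_obs (R := R) x₀ huS (φ := fun _ => 1) fun x y => rfl
  have e3 : ∑ a, w a * spin (a.1 v) = ∑ a, w a * g a := by
    simpa using sum_restrictedWeight_obs (R := R) x₀ hvS (φ := fun _ => 1) fun x y => rfl
  have c1 := fkg_of_monotone hw0 hfm hgm hlat
  have c2 := fkg_of_monotone hw0 hfm hsm hlat
  have c3 := fkg_of_monotone hw0 hsm hgm hlat
  have d1 : ∑ a, w a * (f a - β * s a) = ∑ a, w a * f a - β * ∑ a, w a * s a := by
    rw [mul_sum, ← sum_sub_distrib]; exact sum_congr rfl fun a _ => by ring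
  have d2 : ∑ a, w a * (g a - β * s a) = ∑ a, w a * g a - β * ∑ a, w a * s a := by
    rw [mul_sum, ← sum_sub_distrib]; exact sum_congr rfl fun a _ => by ring
  have hss : ∀ a, s a * s a = 1 := fun a => spin_mul_self _
  have d3 : ∑ a, w a * ((f a - β * s a) * (g a - β * s a))
      = ∑ a, w a * (f a * g a) - β * ∑ a, w a * (f a * s a) - β * ∑ a, w a * (g a * s a)
        + β ^ 2 * N := by
    rw [mul_sum, mul_sum, hN, mul_sum, ← sum_sub_distrib, ← sum_sub_distrib, ← sum_add_distrib]
    exact sum_congr rfl fun a _ => by linear_combination w a * β ^ 2 * hss a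
  have d4 : ∑ a, w a * ((f a - β * s a) * s a) = ∑ a, w a * (f a * s a) - β * N := by
    rw [hN, mul_sum, ← sum_sub_distrib]
    exact sum_congr rfl fun a _ => by linear_combination -w a * β * hss a
  have d5 : ∑ a, w a * (s a * (g a - β * s a)) = ∑ a, w a * (g a * s a) - β * N := by
    rw [hN, mul_sum, ← sum_sub_distrib]
    exact sum_congr rfl fun a _ => by linear_combination -w a * β * hss a
  rw [d1, d2, d3] at c1
  rw [d1, d4] at c2
  rw [d2, d5] at c3
  -- Lower bound for `Var(s)`: as `s² = 1`, it suffices to bound the mean of `s`, which is the mean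
  -- of the `tanh` of a field of size at most `λ`.
  have hvar : (∑ a, w a * s a) ^ 2 ≤ (1 - Real.exp (-2 * lam)) * N ^ 2 := by
    rw [sum_restrictedWeight_lat]
    calc (∑ a, w a * Real.tanh (R.latField a.1 j)) ^ 2
        ≤ (∑ a, w a * Real.tanh (R.latField a.1 j) ^ 2) * ∑ a, w a :=
          sum_sq_le_sum_mul_sum_of_sq_le_mul _ (fun a _ => mul_nonneg (hw0 a) (sq_nonneg _))
            (fun a _ => hw0 a) fun a _ => le_of_eq (by ring)
      _ ≤ (∑ a, w a * (1 - Real.exp (-2 * lam))) * ∑ a, w a :=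
          mul_le_mul_of_nonneg_right (sum_le_sum fun a _ => mul_le_mul_of_nonneg_left
            (tanh_sq_le (hR.abs_latField_le a.1 j)) (hw0 a)) hNpos.le
      _ = _ := by rw [← sum_mul]; ring
  have hE : α ^ 2 * Real.exp (-6 * lam) = β ^ 2 * Real.exp (-2 * lam) := by
    rw [hβ, mul_pow, mul_assoc, ← Real.exp_nat_mul, ← Real.exp_add]
    congr 2; push_cast; ring
  have key : β ^ 2 * Real.exp (-2 * lam) * N ^ 2
      ≤ N * (∑ a, w a * (f a * g a)) - (∑ a, w a * f a) * ∑ a, w a * g a := by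
    have := mul_le_mul_of_nonneg_left hvar (sq_nonneg β)
    have := mul_le_mul_of_nonneg_left c2 hβ0
    have := mul_le_mul_of_nonneg_left c3 hβ0
    nlinarith
  rw [condCov, condMean_obsProb, condMean_obsProb, condMean_obsProb, ← hw, e1, e2, e3, hE,
    ← hN]
  have : (∑ a, w a * (f a * g a)) / N - (∑ a, w a * f a) / N * ((∑ a, w a * g a) / N)
      = (N * (∑ a, w a * (f a * g a)) - (∑ a, w a * f a) * ∑ a, w a * g a) / N ^ 2 := by
    field_simp
  rw [this, le_div_iff₀ (by positivity)]
  exact key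

end Ferromagnetic

/-! ### Reduction to the ferromagnetic case. -/

section SignNormalization

open Classical in
/-- Whether all interactions of a latent spin are nonnegative. The other latent spins are reversed
to obtain a ferromagnetic model. -/
noncomputable def latSign (R : RBM n m) (j : Fin m) : Bool := decide (∀ i, 0 ≤ R.J i j)

/-- The ferromagnetic model that is obtained by reversing latent spins. -/
noncomputable def ferromagnetic (R : RBM n m) : RBM n m where
  J i j := spin (R.latSign j) * R.J i j
  h := R.h
  g j := spin (R.latSign j) * R.g j

lemma LocallyConsistent.ferromagnetic_J_nonneg (hR : R.LocallyConsistent α lam) (i : Fin n)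
    (j : Fin m) : 0 ≤ R.ferromagnetic.J i j := by
  by_cases h : ∀ i, 0 ≤ R.J i j
  · simp [ferromagnetic, latSign, h, spin]
  · simpa [ferromagnetic, latSign, h, spin] using (hR.sign j).resolve_left h i

lemma ferromagnetic_J_eq_zero_iff (i : Fin n) (j : Fin m) :
    R.ferromagnetic.J i j = 0 ↔ R.J i j = 0 := by
  cases h : R.latSign j <;> simp [ferromagnetic, spin, h]

lemma LocallyConsistent.ferromagnetic (hR : R.LocallyConsistent α lam) :
    R.ferromagnetic.LocallyConsistent α lam where
  sign j := Or.inl fun i => hR.ferromagnetic_J_nonneg i j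
  edge i j h := by
    have := hR.edge i j fun h' => h (ferromagnetic_J_eq_zero_iff i j |>.2 h')
    simpa [RBM.ferromagnetic, abs_mul, abs_spin] using this
  obs i := by simpa [RBM.ferromagnetic, abs_mul, abs_spin] using hR.obs i
  lat j := by simpa [RBM.ferromagnetic, abs_mul, abs_spin] using hR.lat j

/-- Reversing some latent spins permutes the latent configurations, which is invisible after summing
over them. -/
lemma obsProb_ferromagnetic (R : RBM n m) : R.ferromagnetic.obsProb = R.obsProb := by
  set σ : Config m → Config m := fun y j => bif R.latSign j then y j else !y j with hσ
  have hinv : Function.Involutive σ := fun y => by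
    funext j; cases h : R.latSign j <;> simp [hσ, h]
  have hspin : ∀ y j, spin (σ y j) = spin (R.latSign j) * spin (y j) := fun y j => by
    cases h : R.latSign j <;> cases h' : y j <;> simp [hσ, h, h', spin]
  have hw : ∀ x y, R.ferromagnetic.weight x y = R.weight x (σ y) := fun x y => by
    simp only [weight, ferromagnetic, hspin]
    congr 2
    · congr 1
      exact sum_congr rfl fun i _ => sum_congr rfl fun j _ => by ring
    · exact sum_congr rfl fun j _ => by ring
  have hs : ∀ x, ∑ y, R.ferromagnetic.weight x y = ∑ y, R.weight x y := fun x => by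
    simp only [hw]
    exact Equiv.sum_comp hinv.toPerm fun y => R.weight x y
  funext x
  rw [obsProb_eq, obsProb_eq, partition, partition, hs]
  simp only [hs]

end SignNormalization

/-- Two-hop neighbors have a large average conditional covariance. -/
lemma LocallyConsistent.le_covAvg (hR : R.LocallyConsistent α lam) (hα : 0 < α) {u v : Fin n}
    (h : R.IsTwoHop u v) {S : Finset (Fin n)} (hu : u ∉ S) (hv : v ∉ S) :
    α ^ 2 * Real.exp (-12 * lam) ≤ covAvg R.obsProb u v S := by
  obtain ⟨hvu, j, hvj, huj⟩ := h
  have hcov : ∀ x, α ^ 2 * Real.exp (-6 * lam) ≤ condCov R.obsProb u v S x := fun x => by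
    rw [← obsProb_ferromagnetic]
    exact hR.ferromagnetic.le_condCov_of_nonneg hα hR.ferromagnetic_J_nonneg hvu.symm
      (mt (ferromagnetic_J_eq_zero_iff u j).1 huj) (mt (ferromagnetic_J_eq_zero_iff v j).1 hvj)
      hu hv x
  have h0 := hR.nonneg u
  -- The argument gives the exponent `-6λ`; the weaker `-12λ` is the one that matches `2τ`.
  calc α ^ 2 * Real.exp (-12 * lam) ≤ α ^ 2 * Real.exp (-6 * lam) :=
        mul_le_mul_of_nonneg_left (Real.exp_le_exp.2 (by linarith)) (sq_nonneg α)
    _ = ∑ x, R.obsProb x * (α ^ 2 * Real.exp (-6 * lam)) := by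
        rw [← sum_mul, R.sum_obsProb, one_mul]
    _ ≤ _ := sum_le_sum fun x _ => mul_le_mul_of_nonneg_left (hcov x) (R.obsProb_nonneg x)

/-! ### Markov property of the observed law. -/

section Markov

/-- Given `x` the weight factors over the latent nodes, so each latent spin can be summed out
separately. -/
lemma sum_weight_eq_prod (R : RBM n m) (x : Config n) :
    ∑ y, R.weight x y
      = (∏ i, Real.exp (R.h i * spin (x i))) * ∏ j, (2 * Real.cosh (R.latField x j)) := by
  have h1 : ∀ y, R.weight x y = (∏ i, Real.exp (R.h i * spin (x i))) *
      ∏ j, Real.exp (spin (y j) * R.latField x j) := fun y => by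
    rw [weight_eq_latField, Real.exp_add, Real.exp_sum, Real.exp_sum, mul_comm]
  have h2 : ∀ j, 2 * Real.cosh (R.latField x j)
      = ∑ b : Bool, Real.exp (spin b * R.latField x j) := fun j => by
    simp [spin, Real.cosh_eq]; ring
  simp only [h1, ← mul_sum, h2, prod_univ_sum, Fintype.piFinset_univ]

/-- The factor of the observed law that involves the node `u`. -/
noncomputable def localFactor (R : RBM n m) (u : Fin n) (x : Config n) : ℝ :=
  Real.exp (R.h u * spin (x u)) *
    ∏ j with R.J u j ≠ 0, (2 * Real.cosh (R.latField x j))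

lemma localFactor_pos (u : Fin n) (x : Config n) : 0 < R.localFactor u x :=
  mul_pos (Real.exp_pos _) (prod_pos fun _ _ => mul_pos two_pos (Real.cosh_pos _))

/-- The latent neighbors of `u` are adjacent only to `u` and to its two-hop neighbors. -/
lemma localFactor_congr {u : Fin n} {x z : Config n} (h : x u = z u)
    (h' : ∀ i, R.IsTwoHop u i → x i = z i) : R.localFactor u x = R.localFactor u z := by
  unfold localFactor latField
  rw [h]
  congr 1
  refine prod_congr rfl fun j hj => ?_
  congr 3
  refine sum_congr rfl fun i _ => ?_
  by_cases hi : R.J i j = 0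
  · simp [hi]
  · by_cases hiu : i = u
    · rw [hiu, h]
    · rw [h' i ⟨hiu, j, hi, (mem_filter.1 hj).2⟩]

lemma exists_obsProb_eq_localFactor_mul (R : RBM n m) (u : Fin n) :
    ∃ B : Config n → ℝ, (∀ x, B (flipAt u x) = B x) ∧
      ∀ x, R.obsProb x = R.localFactor u x * B x := by
  refine ⟨fun x => (∏ i ∈ univ.erase u, Real.exp (R.h i * spin (x i))) *
    (∏ j with ¬R.J u j ≠ 0, (2 * Real.cosh (R.latField x j))) / R.partition,
    fun x => ?_, fun x => ?_⟩
  · refine congrArg (· / _) (congrArg₂ (· * ·) ?_ ?_)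
    · exact prod_congr rfl fun i hi => by rw [flipAt_of_ne (ne_of_mem_erase hi)]
    · refine prod_congr rfl fun j hj => ?_
      have hj' : R.J u j = 0 := not_not.1 (mem_filter.1 hj).2
      refine congrArg (fun r => 2 * Real.cosh (R.g j + r)) ?_
      refine sum_congr rfl fun i _ => ?_
      by_cases hi : i = u
      · rw [hi, hj', zero_mul, zero_mul]
      · rw [flipAt_of_ne hi]
  · rw [obsProb_eq, sum_weight_eq_prod, localFactor,
      ← prod_filter_mul_prod_filter_not univ (fun j => R.J u j ≠ 0),
      ← mul_prod_erase univ (fun i => Real.exp (R.h i * spin (x i))) (mem_univ u)]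
    ring

/-- Given its two-hop neighborhood, an observed node is independent of the other ones. -/
lemma condCov_eq_zero (R : RBM n m) {u v : Fin n} (huv : v ≠ u) {S : Finset (Fin n)}
    (hu : u ∉ S) (hS : ∀ i, R.IsTwoHop u i → i ∈ S) (x₀ : Config n) :
    condCov R.obsProb u v S x₀ = 0 := by
  obtain ⟨B, hB, hp⟩ := R.exists_obsProb_eq_localFactor_mul u
  set a := R.localFactor u (Function.update x₀ u true) with ha
  set b := R.localFactor u (Function.update x₀ u false) with hb
  have hab : a + b ≠ 0 := (add_pos (R.localFactor_pos u _) (R.localFactor_pos u _)).ne'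
  -- The conditional mean of `X_u` on the cell: `a` and `b` are the relative weights of the values
  -- `+1` and `-1`.
  set t := (a - b) / (a + b) with ht
  have htab : t * (a + b) = a - b := div_mul_cancel₀ _ hab
  have hloc : ∀ z, AgreeOn S x₀ z →
      R.localFactor u z = if z u then a else b := fun z hz => by
    have : ∀ c, z u = c → R.localFactor u z = R.localFactor u (Function.update x₀ u c) :=
      fun c hc => localFactor_congr (by simp [hc]) fun i hi => by
        rw [Function.update_of_ne hi.1, hz i (hS i hi)]
    cases h : z u
    · simpa using this _ h
    · simpa using this _ h
  -- With `φ = X_v` and `φ = 1` this says that `X_u` contributes the constant factor `t` to both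
  -- means, so the covariance is zero.
  have key : ∀ φ : Config n → ℝ, (∀ z, φ (flipAt u z) = φ z) →
      ∑ z with AgreeOn S x₀ z, R.obsProb z * (spin (z u) * φ z)
        = t * ∑ z with AgreeOn S x₀ z, R.obsProb z * φ z := by
    intro φ hφ
    rw [mul_sum, ← sub_eq_zero, ← sum_sub_distrib, sum_filter]
    refine sum_eq_zero_of_involutive (flipAt_involutive u) fun z => ?_
    simp only [agreeOn_flipAt hu]
    split_ifs with hz
    · rw [hp, hp, hφ, hB, hloc z hz, hloc _ ((agreeOn_flipAt hu x₀ z).2 hz), flipAt_self]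
      cases h : z u
      · simp only [spin, Bool.not_false, if_true, Bool.false_eq_true, if_false]
        linear_combination -(B z * φ z) * htab
      · simp only [spin, Bool.not_true, if_true, Bool.false_eq_true, if_false]
        linear_combination -(B z * φ z) * htab
    · simp
  have k1 := key (fun z => spin (z v)) fun z => by rw [flipAt_of_ne huv]
  have k2 := key (fun _ => 1) fun z => rfl
  simp only [mul_one] at k2
  have hq := (R.margProb_obsProb_pos S x₀).ne'
  rw [condCov, condMean, condMean, condMean, k1, k2]
  change _ / _ - t * margProb R.obsProb S x₀ / _ * _ = 0
  field_simp
  ring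

lemma covAvg_eq_zero (R : RBM n m) {u v : Fin n} (huv : v ≠ u) {S : Finset (Fin n)}
    (hu : u ∉ S) (hS : ∀ i, R.IsTwoHop u i → i ∈ S) : covAvg R.obsProb u v S = 0 := by
  simp [covAvg, R.condCov_eq_zero huv hu hS]

end Markov

end RBM

/-! ### Stability of the average covariance under small changes of marginals. -/

section Deviation

variable {n : ℕ} {p q : Config n → ℝ} {S : Finset (Fin n)} {ε : ℝ}

/-- The map `ab/c` has partial derivatives `b/c`, `a/c` and `-ab/c²`, all bounded by `1` where `|a|,
|b| ≤ c`. Hence small denominators do no harm, and even `c = 0` is allowed. -/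
lemma abs_mul_div_sub_le {a b c a' b' c' : ℝ} (ha : |a| ≤ c) (hb : |b| ≤ c) (ha' : |a'| ≤ c') :
    |a * b / c - a' * b' / c'| ≤ |a - a'| + |b - b'| + |c - c'| := by
  have hc : 0 ≤ c := (abs_nonneg a).trans ha
  have hc' : 0 ≤ c' := (abs_nonneg a').trans ha'
  have h1 : |b / c| ≤ 1 := by
    rw [abs_div, abs_of_nonneg hc]; exact div_le_one_of_le₀ hb hc
  have h2 : |a' / c'| ≤ 1 := by
    rw [abs_div, abs_of_nonneg hc']; exact div_le_one_of_le₀ ha' hc'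
  have e1 : b / c * c = b := by
    by_cases h : c = 0
    · rw [h] at hb ⊢; simp [abs_nonpos_iff.1 hb]
    · exact div_mul_cancel₀ _ h
  have e2 : a' / c' * c' = a' := by
    by_cases h : c' = 0
    · rw [h] at ha' ⊢; simp [abs_nonpos_iff.1 ha']
    · exact div_mul_cancel₀ _ h
  have e : a * b / c - a' * b' / c'
      = (a - a') * (b / c) + a' / c' * (b - b') - a' / c' * (b / c) * (c - c') := by
    rw [mul_div_assoc, mul_div_right_comm a' b' c']
    linear_combination (-(b / c)) * e2 + a' / c' * e1
  rw [e]
  refine (abs_sub _ _).trans (add_le_add ((abs_add_le _ _).trans (add_le_add ?_ ?_)) ?_)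
  · rw [abs_mul]; exact mul_le_of_le_one_right (abs_nonneg _) h1
  · rw [abs_mul]; exact mul_le_of_le_one_left (abs_nonneg _) h2
  · rw [abs_mul, abs_mul]
    exact mul_le_of_le_one_left (abs_nonneg _) (mul_le_one₀ h2 (abs_nonneg _) h1)

lemma agreeOn_insert_update {u : Fin n} (hu : u ∉ S) (x z : Config n) (b : Bool) :
    AgreeOn (insert u S) (Function.update x u b) z ↔ AgreeOn S x z ∧ z u = b := by
  have h : ∀ i ∈ S, Function.update x u b i = x i := fun i hi =>
    Function.update_of_ne (ne_of_mem_of_not_mem hi hu) _ _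
  constructor
  · intro h'
    refine ⟨fun i hi => (h' i (mem_insert_of_mem hi)).trans (h i hi), ?_⟩
    simpa using h' u (mem_insert_self u S)
  · rintro ⟨h1, h2⟩ i hi
    rcases mem_insert.1 hi with rfl | hi
    · simpa using h2
    · rw [h1 i hi, h i hi]

/-- Splitting a cell by the value of `X_u` trades a spin factor for one more conditioned coordinate.
Two uses reduce all terms of `cellCov` to marginals. -/
lemma sum_agreeOn_mul_spin (p f : Config n → ℝ) {u : Fin n} (hu : u ∉ S) (x : Config n) :
    ∑ z with AgreeOn S x z, p z * (spin (z u) * f z)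
      = ∑ z with AgreeOn (insert u S) (Function.update x u true) z, p z * f z
        - ∑ z with AgreeOn (insert u S) (Function.update x u false) z, p z * f z := by
  simp only [sum_filter, ← sum_sub_distrib, agreeOn_insert_update hu]
  refine sum_congr rfl fun z _ => ?_
  by_cases h : AgreeOn S x z <;> cases h' : z u <;> simp [h, spin]

/-- The contribution of the event `X_S = x_S` to the average conditional covariance. -/
noncomputable def cellCov (p : Config n → ℝ) (u v : Fin n) (S : Finset (Fin n)) (x : Config n) :
    ℝ :=
  (∑ z with AgreeOn S x z, p z * (spin (z u) * spin (z v)))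
    - (∑ z with AgreeOn S x z, p z * spin (z u)) * (∑ z with AgreeOn S x z, p z * spin (z v))
      / margProb p S x

lemma abs_sum_agreeOn_mul_le (hp : ∀ x, 0 ≤ p x) {f : Config n → ℝ} (hf : ∀ x, |f x| ≤ 1)
    (S : Finset (Fin n)) (x : Config n) :
    |∑ z with AgreeOn S x z, p z * f z| ≤ margProb p S x :=
  (abs_sum_le_sum_abs _ _).trans (sum_le_sum fun z _ => by
    rw [abs_mul, abs_of_nonneg (hp z)]; exact mul_le_of_le_one_right (hp z) (hf z))

lemma margProb_mul_condCov (hp : ∀ x, 0 ≤ p x) (u v : Fin n) (S : Finset (Fin n))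
    (x : Config n) : margProb p S x * condCov p u v S x = cellCov p u v S x := by
  unfold condCov condMean cellCov
  by_cases h : margProb p S x = 0
  · have h1 := abs_sum_agreeOn_mul_le hp (f := fun z => spin (z u) * spin (z v))
      (fun z => by rw [abs_mul, abs_spin, abs_spin, one_mul]) S x
    rw [h] at h1 ⊢
    simp [abs_nonpos_iff.1 h1]
  · field_simp

/-- The cells are indexed by the set `c` of nodes of `S` with spin `+1`, so there are `2 ^ #S` of
them. -/
lemma covAvg_eq_sum_cellCov (hp : ∀ x, 0 ≤ p x) (u v : Fin n) (S : Finset (Fin n)) :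
    covAvg p u v S = ∑ c ∈ S.powerset, cellCov p u v S fun i => decide (i ∈ c) := by
  unfold covAvg
  rw [← sum_fiberwise_of_maps_to (s := univ) (t := S.powerset)
    (g := fun x : Config n => S.filter fun i => x i = true)
    fun x _ => mem_powerset.2 (filter_subset _ _)]
  refine sum_congr rfl fun c hc => ?_
  have hset : (univ.filter fun x : Config n => (S.filter fun i => x i = true) = c)
      = univ.filter fun x => AgreeOn S (fun i => decide (i ∈ c)) x := by
    ext x
    simp only [mem_filter, mem_univ, true_and]
    constructor
    · rintro rfl i hi
      cases h : x i <;> simp [hi, h]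
    · intro h
      ext i
      rw [mem_filter]
      constructor
      · rintro ⟨hi, hx⟩
        have := h i hi
        simpa [hx] using this
      · intro hi
        have hiS := mem_powerset.1 hc hi
        refine ⟨hiS, ?_⟩
        rw [h i hiS]
        simpa using hi
  rw [hset, ← margProb_mul_condCov hp, margProb, sum_mul]
  refine sum_congr rfl fun x hx => ?_
  have hx' := (mem_filter.1 hx).2
  simp only [condCov, condMean_congr hx']

lemma abs_sum_agreeOn_spin_sub_le {k : ℕ}
    (h : ∀ W : Finset (Fin n), #W ≤ k → ∀ x, |margProb p W x - margProb q W x| ≤ ε)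
    {u : Fin n} (hu : u ∉ S) (hS : #S + 1 ≤ k) (x : Config n) :
    |∑ z with AgreeOn S x z, p z * spin (z u) - ∑ z with AgreeOn S x z, q z * spin (z u)|
      ≤ 2 * ε := by
  have hc : #(insert u S) ≤ k := by rwa [card_insert_of_notMem hu]
  have ep := sum_agreeOn_mul_spin p (fun _ => 1) hu x
  have eq := sum_agreeOn_mul_spin q (fun _ => 1) hu x
  simp only [mul_one] at ep eq
  rw [ep, eq]
  have h1 := abs_le.1 (h _ hc (Function.update x u true))
  have h2 := abs_le.1 (h _ hc (Function.update x u false))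
  simp only [margProb] at h1 h2
  rw [abs_le]
  constructor <;> linarith

/-- The average conditional covariance is a Lipschitz function of the low-dimensional marginals,
with no lower bound on the probabilities of the conditioning events. -/
lemma abs_covAvg_sub_le (hp : ∀ x, 0 ≤ p x) (hq : ∀ x, 0 ≤ q x) {k : ℕ}
    (h : ∀ W : Finset (Fin n), #W ≤ k → ∀ x, |margProb p W x - margProb q W x| ≤ ε)
    {u v : Fin n} (huv : v ≠ u) (hu : u ∉ S) (hv : v ∉ S) (hS : #S + 2 ≤ k) :
    |covAvg p u v S - covAvg q u v S| ≤ 2 ^ #S * (9 * ε) := by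
  rw [covAvg_eq_sum_cellCov hp, covAvg_eq_sum_cellCov hq, ← sum_sub_distrib]
  refine (abs_sum_le_sum_abs _ _).trans ?_
  -- Here `9 = 4 + 2 + 2 + 1`: four marginals for the mean of `X_u X_v`, two for each single mean,
  -- one for the mass of the cell.
  refine (sum_le_card_nsmul _ _ (9 * ε) fun c _ => ?_).trans_eq ?_
  · set x : Config n := fun i => decide (i ∈ c)
    have d1 := abs_sum_agreeOn_spin_sub_le h hu (by omega) x
    have d2 := abs_sum_agreeOn_spin_sub_le h hv (by omega) x
    have d3 := h S (by omega) x
    have hv' : v ∉ insert u S := by simp [huv, hv]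
    have hc : #(insert u S) + 1 ≤ k := by rw [card_insert_of_notMem hu]; omega
    have d4 := abs_le.1 (abs_sum_agreeOn_spin_sub_le h hv' hc (Function.update x u true))
    have d5 := abs_le.1 (abs_sum_agreeOn_spin_sub_le h hv' hc (Function.update x u false))
    have hs : ∀ (w : Fin n) (z : Config n), |spin (z w)| ≤ 1 := fun w z => (abs_spin _).le
    have d6 := abs_le.1 <| abs_mul_div_sub_le
      (abs_sum_agreeOn_mul_le hp (hs u) S x) (abs_sum_agreeOn_mul_le hp (hs v) S x)
      (b' := ∑ z with AgreeOn S x z, q z * spin (z v)) (abs_sum_agreeOn_mul_le hq (hs u) S x)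
    unfold cellCov
    rw [sum_agreeOn_mul_spin p (fun z => spin (z v)) hu x,
      sum_agreeOn_mul_spin q (fun z => spin (z v)) hu x, abs_le]
    constructor <;> linarith [d6.1, d6.2, d4.1, d4.2, d5.1, d5.2]
  · rw [card_powerset, nsmul_eq_mul]; push_cast; ring

end Deviation

/-! ### Uniform concentration of empirical marginals. -/

section Concentration

variable {n M : ℕ} {p : Config n → ℝ} {Ω : Type*} [MeasurableSpace Ω] {P : Measure Ω}
  [IsProbabilityMeasure P] {X : Fin M → Ω → Config n}

lemma integral_comp_sample {Y : Ω → Config n} (hY : Measurable Y)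
    (hp : ∀ x, P.real {ω | Y ω = x} = p x) (f : Config n → ℝ) :
    ∫ ω, f (Y ω) ∂P = ∑ x, p x * f x := by
  have : IsProbabilityMeasure (P.map Y) := Measure.isProbabilityMeasure_map hY.aemeasurable
  rw [← integral_map (f := f) hY.aemeasurable (measurable_of_finite f).aestronglyMeasurable,
    integral_fintype Integrable.of_finite]
  refine sum_congr rfl fun x _ => ?_
  rw [map_measureReal_apply hY (measurableSet_singleton x), smul_eq_mul, ← hp x]
  rfl

/-- Hoeffding's inequality for the empirical mean of a function with values in `[0, 1]`. -/
lemma measureReal_deviation_le (hX : ∀ k, Measurable (X k)) (hind : iIndepFun X P)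
    (hp : ∀ k x, P.real {ω | X k ω = x} = p x) {f : Config n → ℝ}
    (hf : ∀ x, f x ∈ Set.Icc (0 : ℝ) 1) {ε : ℝ} (hε : 0 ≤ ε) :
    P.real {ω | M * ε ≤ |∑ k, f (X k ω) - M * ∑ x, p x * f x|}
      ≤ 2 * Real.exp (-(2 * M * ε ^ 2)) := by
  set E := ∑ x, p x * f x
  have hsub : ∀ k, HasSubgaussianMGF (fun ω => f (X k ω) - E) ((‖(1 : ℝ) - 0‖₊ / 2) ^ 2) P :=
    fun k => by
      have := hasSubgaussianMGF_of_mem_Icc (μ := P) (X := fun ω => f (X k ω)) (a := 0) (b := 1)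
        ((measurable_of_finite f).comp (hX k)).aemeasurable
        (Filter.Eventually.of_forall fun ω => hf _)
      rwa [integral_comp_sample (hX k) (hp k) f] at this
  have hsub' : ∀ k, HasSubgaussianMGF (fun ω => -(f (X k ω) - E))
      ((‖(1 : ℝ) - 0‖₊ / 2) ^ 2) P := fun k => (hsub k).neg
  have hi1 : iIndepFun (fun k ω => f (X k ω) - E) P :=
    hind.comp (fun _ x => f x - E) fun _ => measurable_of_finite _
  have hi2 : iIndepFun (fun k ω => -(f (X k ω) - E)) P :=
    hind.comp (fun _ x => -(f x - E)) fun _ => measurable_of_finite _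
  have hMε : 0 ≤ M * ε := by positivity
  have b1 := HasSubgaussianMGF.measure_sum_ge_le_of_iIndepFun hi1 (s := univ)
    (fun k _ => hsub k) hMε
  have b2 := HasSubgaussianMGF.measure_sum_ge_le_of_iIndepFun hi2 (s := univ)
    (fun k _ => hsub' k) hMε
  have hexp : -(M * ε) ^ 2 / (2 * ∑ _k : Fin M, (((‖(1 : ℝ) - 0‖₊ / 2) ^ 2 : NNReal) : ℝ))
      = -(2 * M * ε ^ 2) := by
    have : (((‖(1 : ℝ) - 0‖₊ / 2) ^ 2 : NNReal) : ℝ) = 1 / 4 := by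
      push_cast; norm_num
    rw [this]
    simp only [sum_const, card_univ, Fintype.card_fin, nsmul_eq_mul]
    by_cases hM : (M : ℝ) = 0
    · simp [hM]
    · field_simp; ring
  simp only [NNReal.coe_sum, hexp] at b1 b2
  have hset : {ω | M * ε ≤ |∑ k, f (X k ω) - M * E|}
      ⊆ {ω | M * ε ≤ ∑ k, (f (X k ω) - E)} ∪ {ω | M * ε ≤ ∑ k, -(f (X k ω) - E)} := by
    intro ω hω
    have e : ∑ k, (f (X k ω) - E) = ∑ k, f (X k ω) - M * E := by
      rw [sum_sub_distrib]; simp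
    simp only [Set.mem_union, Set.mem_ofPred_eq, sum_neg_distrib, e] at hω ⊢
    exact le_abs.1 hω
  calc _ ≤ _ := measureReal_mono hset
    _ ≤ _ := measureReal_union_le _ _
    _ ≤ _ := by linarith

/-- With high probability all low-dimensional marginals of the empirical distribution are
accurate. -/
lemma le_measureReal_margProb (hM : 0 < M) (hp1 : ∑ x, p x = 1)
    (hX : ∀ k, Measurable (X k)) (hind : iIndepFun X P)
    (hp : ∀ k x, P.real {ω | X k ω = x} = p x) {ε : ℝ} (hε : 0 ≤ ε) (k : ℕ) :
    1 - (n * 2 : ℝ) ^ k * (2 * Real.exp (-(2 * M * ε ^ 2))) ≤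
      P.real {ω | ∀ W : Finset (Fin n), #W ≤ k → ∀ x,
        |margProb (empirical fun l => X l ω) W x - margProb p W x| ≤ ε} := by
  set G := {ω | ∀ W : Finset (Fin n), #W ≤ k → ∀ x,
        |margProb (empirical fun l => X l ω) W x - margProb p W x| ≤ ε}
  -- The events are indexed by words of length exactly `k` in the `2n` pairs (node, value).
  -- Repetitions are allowed, so `(2n)^k` events cover all smaller sets too.
  let f : (Fin k → Fin n × Bool) → Config n → ℝ := fun w x =>
    if ∀ j, x (w j).1 = (w j).2 then 1 else 0
  have hf : ∀ w x, f w x ∈ Set.Icc (0 : ℝ) 1 := fun w x => by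
    simp only [f]; split_ifs <;> simp
  have hsub : Gᶜ ⊆ ⋃ w, {ω | M * ε ≤ |∑ l, f w (X l ω) - M * ∑ x, p x * f w x|} := by
    intro ω hω
    simp only [G, Set.mem_compl_iff, Set.mem_ofPred_eq, not_forall, not_le] at hω
    obtain ⟨W, hW, x, hx⟩ := hω
    have hMr : (0 : ℝ) < M := by exact_mod_cast hM
    -- The empty marginal is exact, as both masses are `1`. A nonempty `W` can be padded to a word
    -- of length `k` by a surjection from `Fin k`.
    have hne : W.Nonempty := by
      rw [nonempty_iff_ne_empty]
      rintro rfl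
      have h1 : ∀ q : Config n → ℝ, margProb q ∅ x = ∑ z, q z := fun q => by
        simp [margProb, AgreeOn]
      rw [h1, h1, sum_empirical hM, hp1] at hx
      simp only [sub_self, abs_zero] at hx
      linarith
    obtain ⟨e⟩ : Nonempty (W ↪ Fin k) :=
      Function.Embedding.nonempty_of_card_le (by simpa using hW)
    have : Nonempty W := hne.to_subtype
    have hsurj := Function.invFun_surjective e.injective
    set t : Fin k → W := Function.invFun e
    let w : Fin k → Fin n × Bool := fun j => (t j, x (t j))
    have hw : ∀ z, AgreeOn W x z ↔ ∀ j, z (w j).1 = (w j).2 := fun z =>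
      ⟨fun h j => h _ (t j).2, fun h i hi => by
        obtain ⟨j, hj⟩ := hsurj ⟨i, hi⟩
        have := h j
        simpa [w, hj] using this⟩
    have hfw : ∀ z, f w z = if AgreeOn W x z then 1 else 0 := fun z => by
      simp only [f, hw]
    refine Set.mem_iUnion.2 ⟨w, ?_⟩
    simp only [Set.mem_ofPred_eq, hfw, mul_ite, mul_one, mul_zero, ← sum_filter]
    rw [margProb_empirical] at hx
    change M * ε ≤ |_ - M * margProb p W x|
    rw [sum_const, nsmul_eq_mul, mul_one]
    have : (#{l | AgreeOn W x (X l ω)} : ℝ) - M * margProb p W x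
        = M * ((#{l | AgreeOn W x (X l ω)} : ℝ) / M - margProb p W x) := by field_simp
    rw [this, abs_mul, abs_of_pos hMr]
    exact mul_le_mul_of_nonneg_left hx.le hMr.le
  have hbad : P.real Gᶜ ≤ (n * 2 : ℝ) ^ k * (2 * Real.exp (-(2 * M * ε ^ 2))) := by
    refine (measureReal_mono hsub).trans ((measureReal_iUnion_fintype_le _).trans ?_)
    refine (sum_le_sum fun w _ => measureReal_deviation_le hX hind hp (hf w) hε).trans_eq ?_
    rw [sum_const, nsmul_eq_mul, card_univ]
    simp
  have h1 : (1 : ℝ) ≤ P.real G + P.real Gᶜ := by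
    have := measureReal_union_le (μ := P) G Gᶜ
    rwa [Set.union_compl_self, probReal_univ] at this
  linarith

end Concentration

/-! ### Analysis of the greedy algorithm. -/

section Greedy

variable {n M : ℕ} {X : Fin M → Config n} {τ : ℝ} {u : Fin n}

lemma Grows.exists (X : Fin M → Config n) (τ : ℝ) (u : Fin n) (S : Finset (Fin n)) :
    ∃ S', Grows X τ u S S' := by
  by_cases h : ∀ v, v ∉ insert u S → empCovAvg X u v S < τ
  · exact ⟨S, .finish S h⟩
  · push Not at h
    obtain ⟨v, hv, hτ⟩ := h
    obtain ⟨i, hi, hmax⟩ := exists_max_image (insert u S)ᶜ (fun w => empCovAvg X u w S)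
      ⟨v, mem_compl.2 hv⟩
    have hi' : i ∉ insert u S := mem_compl.1 hi
    obtain ⟨S', hS'⟩ := Grows.exists X τ u (insert i S)
    exact ⟨S', .step S S' i ⟨hi', fun w hw => hmax w (mem_compl.2 hw)⟩
      (hτ.trans (hmax v (mem_compl.2 hv))) hS'⟩
termination_by #Sᶜ
decreasing_by
  refine card_lt_card (Finset.ssubset_iff_subset_ne.2 ⟨?_, ?_⟩)
  · exact compl_subset_compl.2 (subset_insert i S)
  · intro h
    have : i ∈ Sᶜ := mem_compl.2 fun h' => hi' (mem_insert_of_mem h')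
    rw [← h] at this
    exact mem_compl.1 this (mem_insert_self i S)

/-- Each node that the greedy phase adds explains at least `τ²` of the variance of `X_u`. -/
lemma card_insert_mul_sq_le_explained (hM : 0 < M) (hτ : 0 ≤ τ) {S : Finset (Fin n)}
    (h : #S * τ ^ 2 ≤ explained (empirical X) u S) {i : Fin n}
    (hi : τ ≤ empCovAvg X u i S) :
    #(insert i S) * τ ^ 2 ≤ explained (empirical X) u (insert i S) := by
  have h1 := explained_insert (empirical_nonneg X) (sum_empirical hM X) u i S
  have h2 : τ ^ 2 ≤ covAvg (empirical X) u i S ^ 2 := pow_le_pow_left₀ hτ hi 2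
  have h3 : (#(insert i S) : ℝ) ≤ #S + 1 := by exact_mod_cast card_insert_le i S
  nlinarith [sq_nonneg τ]

/-- The invariant `#S * τ ^ 2 ≤ explained` survives each addition, and `explained ≤ 1` then bounds
the size. -/
lemma Grows.spec (hM : 0 < M) (hτ : 0 ≤ τ) {S S' : Finset (Fin n)} (h : Grows X τ u S S')
    (hu : u ∉ S) (hS : #S * τ ^ 2 ≤ explained (empirical X) u S) :
    u ∉ S' ∧ #S' * τ ^ 2 ≤ 1 ∧ ∀ v, v ∉ insert u S' → empCovAvg X u v S' < τ := by
  induction h with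
  | finish S h =>
    exact ⟨hu, hS.trans (explained_le_one (empirical_nonneg X) (sum_empirical hM X) u S), h⟩
  | step S S' i hi hτi h ih =>
    refine ih ?_ (card_insert_mul_sq_le_explained hM hτ hS hτi)
    have := hi.1
    simp only [mem_insert, not_or] at this ⊢
    exact ⟨Ne.symm this.1, hu⟩

/-- While the current set contains all nodes with `N`, a test keeps a node with `N` and removes any
other one, so this containment persists. The order of the tests is therefore irrelevant. -/
lemma mem_foldl_pruneStep {N : Fin n → Prop} {s : ℕ}
    (hN : ∀ v S, v ≠ u → u ∉ S → v ∉ S → #S ≤ s → N v → τ ≤ empCovAvg X u v S)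
    (hN' : ∀ v S, v ≠ u → u ∉ S → v ∉ S → #S ≤ s → (∀ i, N i → i ∈ S) → ¬ N v →
      empCovAvg X u v S < τ) (l : List (Fin n)) (hl : u ∉ l) :
    ∀ S : Finset (Fin n), u ∉ S → #S ≤ s → (∀ i, N i → i ∈ S) →
      ∀ i, i ∈ l.foldl (pruneStep X τ u) S ↔ i ∈ S ∧ (i ∈ l → N i) := by
  induction l with
  | nil => intro S _ _ _ i; simp
  | cons v l ih =>
    intro S hu hs hNS i
    have hvu : v ≠ u := fun h => hl (h ▸ List.mem_cons_self)
    have hl' : u ∉ l := fun h => hl (List.mem_cons_of_mem _ h)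
    have hue : u ∉ S.erase v := fun h => hu (mem_of_mem_erase h)
    have hse : #(S.erase v) ≤ s := (card_erase_le).trans hs
    rw [List.foldl_cons]
    by_cases hv : N v
    · have : pruneStep X τ u S v = S := by
        rw [pruneStep, if_neg (not_lt.2 (hN v _ hvu hue (notMem_erase v S) hse hv))]
      rw [this, ih hl' S hu hs hNS]
      refine and_congr_right fun hi => ⟨fun h h' => ?_, fun h h' => h (List.mem_cons_of_mem _ h')⟩
      rcases List.mem_cons.1 h' with rfl | h'
      exacts [hv, h h']
    · have hNe : ∀ i, N i → i ∈ S.erase v := fun i hi =>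
        mem_erase.2 ⟨fun h => hv (h ▸ hi), hNS i hi⟩
      have : pruneStep X τ u S v = S.erase v := by
        rw [pruneStep, if_pos (hN' v _ hvu hue (notMem_erase v S) hse hNe hv)]
      rw [this, ih hl' _ hue hse hNe, mem_erase, List.mem_cons]
      constructor
      · rintro ⟨⟨h1, h2⟩, h3⟩
        exact ⟨h2, fun h => h3 (h.resolve_left h1)⟩
      · rintro ⟨h1, h2⟩
        exact ⟨⟨fun h => hv (h ▸ h2 (Or.inl h)), h1⟩, fun h => h2 (Or.inr h)⟩

/-- The algorithm returns exactly the nodes with property `N`, if these are separated from the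
others by their empirical average conditional covariances. -/
lemma learnRBMNbhd_iff (hM : 0 < M) (hτ : 0 ≤ τ) {N : Fin n → Prop} {s : ℕ}
    (hs : ∀ k : ℕ, k * τ ^ 2 ≤ 1 → k ≤ s) (hNu : ¬ N u)
    (hN : ∀ v S, v ≠ u → u ∉ S → v ∉ S → #S ≤ s → N v → τ ≤ empCovAvg X u v S)
    (hN' : ∀ v S, v ≠ u → u ∉ S → v ∉ S → #S ≤ s → (∀ i, N i → i ∈ S) → ¬ N v →
      empCovAvg X u v S < τ) (S : Finset (Fin n)) :
    LearnRBMNbhd X τ u S ↔ ∀ i, i ∈ S ↔ N i := by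
  have key : ∀ S, LearnRBMNbhd X τ u S → ∀ i, i ∈ S ↔ N i := by
    rintro _ ⟨S₀, l, hg, -, hl, rfl⟩ i
    obtain ⟨hu, hcard, hfinal⟩ := hg.spec hM hτ (notMem_empty u)
      (by simpa using explained_nonneg (empirical_nonneg X) u ∅)
    -- A missing node with `N` would still reach the threshold, and the greedy phase would not have
    -- stopped.
    have hsub : ∀ i, N i → i ∈ S₀ := fun i hi => by
      by_contra h
      have hiu : i ≠ u := fun h' => hNu (h' ▸ hi)
      exact (hfinal i (by simp [hiu, h])).not_ge (hN i S₀ hiu hu h (hs _ hcard) hi)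
    have hmem : ∀ i, i ∈ l ↔ i ∈ S₀ := fun i => by rw [← hl, List.mem_toFinset]
    rw [mem_foldl_pruneStep hN hN' l (fun h => hu ((hmem u).1 h)) S₀ hu (hs _ hcard) hsub,
      hmem]
    exact ⟨fun h => h.2 h.1, fun h => ⟨hsub i h, fun _ => h⟩⟩
  refine ⟨key S, fun h => ?_⟩
  -- Conversely some output exists, and by `key` it has the same elements as `S`.
  obtain ⟨S₀, hS₀⟩ := Grows.exists X τ u ∅
  have hout : LearnRBMNbhd X τ u (S₀.toList.foldl (pruneStep X τ u) S₀) :=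
    ⟨S₀, S₀.toList, hS₀, nodup_toList S₀, toList_toFinset S₀, rfl⟩
  have : S = S₀.toList.foldl (pruneStep X τ u) S₀ := by
    ext i
    rw [h i, key _ hout i]
  rwa [this]

end Greedy

/-! ### Sample complexity. -/

section SampleComplexity

variable {n m M : ℕ} {R : RBM n m} {α lam δ : ℝ}

lemma IsCondProbLowerBound.le_one {p : Config n → ℝ} (hp : ∀ x, 0 ≤ p x)
    (h : IsCondProbLowerBound p δ) (i : Fin n) : δ ≤ 1 :=
  (h.2 i fun _ => true).trans (div_le_one_of_le₀ (le_margProb hp _ _) (margProb_nonneg hp _ _))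

/-- The sample size of the theorem makes the union bound over all marginals of order `s + 2`
work. -/
lemma union_bound_le {ζ τ T : ℝ} {s : ℕ} (hn : 2 ≤ n) (hδ : 0 < δ) (hδ1 : δ ≤ 1) (hζ : 0 < ζ)
    (hτ : 0 < τ) (hs : (s : ℝ) ≤ T / 8) (hT : 2 ≤ T)
    (hM : 512 * ((Real.log (1 / ζ) + T * Real.log n)
            * ((2 : ℝ) ^ (2 * T) / (τ ^ 2 * δ ^ (2 * T)))) ≤ M) (hζ1 : ζ < 1) :
    (n * 2 : ℝ) ^ (s + 2) * (2 * Real.exp (-(2 * M * (τ / (10 * 2 ^ s)) ^ 2))) ≤ ζ := by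
  have hnr : (2 : ℝ) ≤ n := by exact_mod_cast hn
  have hn0 : (0 : ℝ) < n := by linarith
  set L := Real.log (1 / ζ) with hL
  set K := Real.log n with hK
  have hL0 : 0 ≤ L := Real.log_nonneg (by rw [le_div_iff₀ hζ]; linarith)
  have hlog2 : Real.log 2 ≤ K := Real.log_le_log two_pos hnr
  have hK0 : 0 ≤ K := (Real.log_nonneg one_le_two).trans hlog2
  have hLT : 0 ≤ L + T * K := by positivity
  have hpow : (2 : ℝ) ^ s * 2 ^ s ≤ (2 : ℝ) ^ (2 * T) := by
    rw [← pow_add, ← Real.rpow_natCast]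
    refine Real.rpow_le_rpow_of_exponent_le one_le_two ?_
    push_cast; linarith
  have hδT : δ ^ (2 * T) ≤ 1 := Real.rpow_le_one hδ.le hδ1 (by linarith)
  have hδT0 : 0 < δ ^ (2 * T) := Real.rpow_pos_of_pos hδ _
  have h2s : (0 : ℝ) < 2 ^ s := by positivity
  -- As `δ ≤ 1`, the factor `δ ^ (-2T)` is at least `1` and can be dropped; `s ≤ T / 8` bounds `4 ^
  -- s`.
  have h1 : 512 * (L + T * K) * ((2 : ℝ) ^ s * 2 ^ s) ≤ M * τ ^ 2 := by
    calc 512 * (L + T * K) * ((2 : ℝ) ^ s * 2 ^ s)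
        ≤ 512 * (L + T * K) * (2 : ℝ) ^ (2 * T) := by gcongr
      _ ≤ 512 * (L + T * K) * ((2 : ℝ) ^ (2 * T) / δ ^ (2 * T)) := by
        gcongr
        exact le_div_self (by positivity) hδT0 hδT
      _ = 512 * ((L + T * K) * ((2 : ℝ) ^ (2 * T) / (τ ^ 2 * δ ^ (2 * T)))) * τ ^ 2 := by
        field_simp
      _ ≤ M * τ ^ 2 := by gcongr
  have h2 : L + 4 * (T * K) ≤ 2 * M * (τ / (10 * 2 ^ s)) ^ 2 := by
    have : 2 * M * (τ / (10 * 2 ^ s)) ^ 2 = M * τ ^ 2 / (50 * ((2 : ℝ) ^ s * 2 ^ s)) := by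
      field_simp; ring
    rw [this, le_div_iff₀ (by positivity)]
    refine le_trans ?_ h1
    have : 0 ≤ T * K := by positivity
    have : 50 * (L + 4 * (T * K)) ≤ 512 * (L + T * K) := by linarith
    nlinarith [mul_pos h2s h2s]
  -- From `log 2 ≤ log n` and `s + 2 ≤ 9T/8` the logarithm is at most `(9/4) T K + K`, and `K ≤ T K
  -- / 2`.
  have h3 : (n * 2 : ℝ) ^ (s + 2) * 2 ≤ Real.exp (4 * (T * K)) := by
    have hn2 : (n * 2 : ℝ) = Real.exp (K + Real.log 2) := by
      rw [Real.exp_add, Real.exp_log hn0, Real.exp_log two_pos]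
    rw [hn2, ← Real.exp_nat_mul]
    nth_rewrite 2 [← Real.exp_log (two_pos : (0 : ℝ) < 2)]
    rw [← Real.exp_add, Real.exp_le_exp]
    push_cast
    have hs2 : ((s : ℝ) + 2) ≤ 9 / 8 * T := by linarith
    have : ((s : ℝ) + 2) * (K + Real.log 2) ≤ 9 / 8 * T * (K + K) := by gcongr
    have : 2 * K ≤ T * K := by gcongr
    linarith
  calc (n * 2 : ℝ) ^ (s + 2) * (2 * Real.exp (-(2 * M * (τ / (10 * 2 ^ s)) ^ 2)))
      = (n * 2 : ℝ) ^ (s + 2) * 2 * Real.exp (-(2 * M * (τ / (10 * 2 ^ s)) ^ 2)) := by ring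
    _ ≤ Real.exp (4 * (T * K)) * Real.exp (-(L + 4 * (T * K))) := by gcongr
    _ = Real.exp (-L) := by rw [← Real.exp_add]; ring_nf
    _ = ζ := by rw [hL, one_div, Real.log_inv, neg_neg, Real.exp_log hζ]

/-- Sample complexity of the greedy algorithm. -/
lemma RBM.LocallyConsistent.le_measureReal_learnRBMNbhd (hR : R.LocallyConsistent α lam)
    (hα : 0 < α) (hδ : IsCondProbLowerBound R.obsProb δ) {ζ τ T : ℝ} (hζ : 0 < ζ)
    (hζ1 : ζ < 1) (hτ : τ = α ^ 2 / 2 * Real.exp (-12 * lam)) (hT : T = 8 / τ ^ 2)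
    (hM : 512 * ((Real.log (1 / ζ) + T * Real.log n)
            * ((2 : ℝ) ^ (2 * T) / (τ ^ 2 * δ ^ (2 * T)))) ≤ M)
    {Ω : Type*} [MeasurableSpace Ω] (P : Measure Ω) [IsProbabilityMeasure P]
    {X : Fin M → Ω → Config n} (hX : ∀ k, Measurable (X k)) (hind : iIndepFun X P)
    (hp : ∀ k x, P.real {ω | X k ω = x} = R.obsProb x) :
    1 - ζ ≤ P.real {ω | ∀ (u : Fin n) (S : Finset (Fin n)),
      LearnRBMNbhd (fun k => X k ω) τ u S ↔ ∀ i, i ∈ S ↔ R.IsTwoHop u i} := by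
  have hτ0 : 0 < τ := by rw [hτ]; positivity
  have hT0 : 0 < T := by rw [hT]; positivity
  -- Strict positivity of `log (1 / ζ)` forces at least one sample, even when `log n = 0`.
  have hM0 : 0 < M := by
    have h1 : 0 < Real.log (1 / ζ) := Real.log_pos (by rw [lt_div_iff₀ hζ]; linarith)
    have h2 : 0 ≤ Real.log n := Real.log_natCast_nonneg n
    have h3 : 0 < δ ^ (2 * T) := Real.rpow_pos_of_pos hδ.1 _
    have h4 : 0 < (2 : ℝ) ^ (2 * T) := by positivity
    have h5 : 0 < Real.log (1 / ζ) + T * Real.log n := by positivity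
    have h6 : (0 : ℝ) < M := lt_of_lt_of_le (by positivity) hM
    exact_mod_cast h6
  -- `T / 8 = 1 / τ²`, the maximal size of the greedy set.
  set s := ⌊T / 8⌋₊ with hs
  have hsT : (s : ℝ) ≤ T / 8 := Nat.floor_le (by positivity)
  have hcard : ∀ k : ℕ, k * τ ^ 2 ≤ 1 → k ≤ s := fun k hk => by
    refine Nat.le_floor ?_
    rw [hT, div_div, mul_comm, ← div_div, div_self (by norm_num), le_div_iff₀ (by positivity)]
    exact hk
  have h2τ : 2 * τ = α ^ 2 * Real.exp (-12 * lam) := by rw [hτ]; ring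
  -- Deterministic part: true values are at least `2τ` or equal to `0`, so an error below `τ` leaves
  -- them on the correct side of `τ`.
  have hdet : ∀ ω, (∀ (u v : Fin n) (S : Finset (Fin n)), v ≠ u → u ∉ S → v ∉ S → #S ≤ s →
      |empCovAvg (fun k => X k ω) u v S - covAvg R.obsProb u v S| < τ) →
      ∀ (u : Fin n) (S : Finset (Fin n)),
        LearnRBMNbhd (fun k => X k ω) τ u S ↔ ∀ i, i ∈ S ↔ R.IsTwoHop u i := by
    intro ω hω u S
    refine learnRBMNbhd_iff hM0 hτ0.le hcard (fun h => h.1 rfl) (fun v S hvu hu hv hS hN => ?_)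
      (fun v S hvu hu hv hS hNS hN => ?_) S
    · have h1 := (abs_lt.1 (hω u v S hvu hu hv hS)).1
      have h2 := hR.le_covAvg hα hN hu hv
      linarith
    · have h1 := (abs_lt.1 (hω u v S hvu hu hv hS)).2
      rw [R.covAvg_eq_zero hvu hu hNS] at h1
      linarith
  have hall : ∀ {A : Set Ω}, (∀ ω, ω ∈ A) → 1 - ζ ≤ P.real A := fun hA => by
    rw [Set.eq_univ_of_forall hA, probReal_univ]; linarith
  -- There is no pair of distinct nodes; the union bound below needs `log 2 ≤ log n`.
  by_cases hn : n < 2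
  · refine hall fun ω => hdet ω fun u v S hvu => ?_
    exact absurd (Fin.ext (by omega)) hvu
  -- Covariances lie in `[-1, 1]`, so they never differ by more than `2`. Otherwise `τ ≤ 2`, which
  -- is `T ≥ 2`.
  by_cases hτ2 : 2 < τ
  · refine hall fun ω => hdet ω fun u v S hvu hu hv hS => ?_
    have h1 := abs_covAvg_le_one R.obsProb_nonneg R.sum_obsProb u v S
    have h2 := abs_covAvg_le_one (empirical_nonneg fun k => X k ω) (sum_empirical hM0 _) u v S
    have h3 := abs_sub (covAvg (empirical fun k => X k ω) u v S) (covAvg R.obsProb u v S)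
    rw [empCovAvg]
    linarith
  push Not at hn hτ2
  have hT2 : 2 ≤ T := by
    rw [hT, le_div_iff₀ (by positivity)]; nlinarith
  have hub := union_bound_le hn hδ.1 (hδ.le_one R.obsProb_nonneg ⟨0, by omega⟩) hζ hτ0 hsT hT2
    hM hζ1
  have hε : 0 ≤ τ / (10 * 2 ^ s) := by positivity
  have hprob := le_measureReal_margProb hM0 R.sum_obsProb hX hind hp hε (s + 2)
  refine le_trans (by linarith) (hprob.trans (measureReal_mono ?_))
  refine fun ω hω => hdet ω fun u v S hvu hu hv hS => ?_
  have h2s : (0 : ℝ) < 2 ^ s := by positivity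
  calc _ ≤ 2 ^ #S * (9 * (τ / (10 * 2 ^ s))) :=
        abs_covAvg_sub_le (empirical_nonneg _) R.obsProb_nonneg hω hvu hu hv (by omega)
    _ ≤ 2 ^ s * (9 * (τ / (10 * 2 ^ s))) := by gcongr; exact one_le_two
    _ = 9 / 10 * τ := by field_simp
    _ < τ := by linarith

end SampleComplexity

/-! ### Program logic for the real RAM. -/

section Semantics

/-- The arrays of natural numbers that a program may write to. -/
def Prog.natMods : Prog → List ℕ
  | .skip => []
  | .setNat a _ _ => [a]
  | .setReal _ _ _ => []
  | .seq P Q => P.natMods ++ Q.natMods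
  | .ite _ P Q => P.natMods ++ Q.natMods
  | .loop _ P => P.natMods

/-- The arrays of reals that a program may write to. -/
def Prog.realMods : Prog → List ℕ
  | .skip => []
  | .setNat _ _ _ => []
  | .setReal a _ _ => [a]
  | .seq P Q => P.realMods ++ Q.realMods
  | .ite _ P Q => P.realMods ++ Q.realMods
  | .loop _ P => P.realMods

/-- The memories `s` and `s'` agree on all arrays that `P` does not write to. -/
structure Frame (P : Prog) (s s' : Memory) : Prop where
  nat : ∀ a, a ∉ P.natMods → s'.nat a = s.nat a
  real : ∀ a, a ∉ P.realMods → s'.real a = s.real a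

lemma Frame.refl (P : Prog) (s : Memory) : Frame P s s := ⟨fun _ _ => rfl, fun _ _ => rfl⟩

lemma Frame.trans {P : Prog} {s s' s'' : Memory} (h : Frame P s s') (h' : Frame P s' s'') :
    Frame P s s'' :=
  ⟨fun a ha => (h'.nat a ha).trans (h.nat a ha), fun a ha => (h'.real a ha).trans (h.real a ha)⟩

lemma Frame.mono {P Q : Prog} {s s' : Memory} (h : Frame P s s') (hn : P.natMods ⊆ Q.natMods)
    (hr : P.realMods ⊆ Q.realMods) : Frame Q s s' :=
  ⟨fun a ha => h.nat a fun h' => ha (hn h'), fun a ha => h.real a fun h' => ha (hr h')⟩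

@[simp] lemma Memory.setNat_real (s : Memory) (a i v : ℕ) : (s.setNat a i v).real = s.real := rfl

@[simp] lemma Memory.setReal_nat (s : Memory) (a i : ℕ) (v : ℝ) :
    (s.setReal a i v).nat = s.nat := rfl

@[simp] lemma Memory.setNat_nat (s : Memory) (a i v b j : ℕ) :
    (s.setNat a i v).nat b j = if b = a ∧ j = i then v else s.nat b j := by
  by_cases h : b = a
  · subst h
    by_cases h' : j = i <;> simp [Memory.setNat, h']
  · simp [Memory.setNat, h]

@[simp] lemma Memory.setReal_real (s : Memory) (a i : ℕ) (v : ℝ) (b j : ℕ) :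
    (s.setReal a i v).real b j = if b = a ∧ j = i then v else s.real b j := by
  by_cases h : b = a
  · subst h
    by_cases h' : j = i <;> simp [Memory.setReal, h']
  · simp [Memory.setReal, h]

lemma Exec.frame {P : Prog} {s s' : Memory} {t : ℕ} (h : Exec P s t s') : Frame P s s' := by
  induction h with
  | skip s => exact .refl _ _
  | setNat s a i e =>
    exact ⟨fun b hb => by
      have : b ≠ a := by simpa [Prog.natMods] using hb
      simp [Memory.setNat, this], fun _ _ => rfl⟩
  | setReal s a i e =>
    exact ⟨fun _ _ => rfl, fun b hb => by
      have : b ≠ a := by simpa [Prog.realMods] using hb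
      simp [Memory.setReal, this]⟩
  | seq hP hQ ihP ihQ =>
    exact (ihP.mono (List.subset_append_left _ _) (List.subset_append_left _ _)).trans
      (ihQ.mono (List.subset_append_right _ _) (List.subset_append_right _ _))
  | iteTrue hb hP ih => exact ih.mono (List.subset_append_left _ _) (List.subset_append_left _ _)
  | iteFalse hb hQ ih =>
    exact ih.mono (List.subset_append_right _ _) (List.subset_append_right _ _)
  | loopEnd hb => exact .refl _ _
  | @loopStep b P _ _ _ _ _ hb hP hL ihP ihL =>
    have h' := ihP.mono (Q := .loop b P) (fun _ h => h) fun _ h => h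
    exact h'.trans ihL

/-- Started in `s`, the program `P` halts within `B` steps, in a memory that satisfies `Q`. -/
def Triple (P : Prog) (s : Memory) (B : ℕ) (Q : Memory → Prop) : Prop :=
  ∃ t s', Exec P s t s' ∧ t ≤ B ∧ Q s'

namespace Triple

variable {P P' : Prog} {s : Memory} {B B' : ℕ} {Q Q' : Memory → Prop}

lemma mono (h : Triple P s B Q) (hB : B ≤ B') (hQ : ∀ s', Frame P s s' → Q s' → Q' s') :
    Triple P s B' Q' := by
  obtain ⟨t, s', h1, h2, h3⟩ := h
  exact ⟨t, s', h1, h2.trans hB, hQ s' h1.frame h3⟩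

lemma skip (h : Q s) : Triple .skip s 1 Q := ⟨1, s, .skip s, le_rfl, h⟩

lemma setNat {a : ℕ} {i e : NExpr} (h : Q (s.setNat a (i.eval s) (e.eval s))) :
    Triple (.setNat a i e) s (i.cost + e.cost + 1) Q := ⟨_, _, .setNat s a i e, le_rfl, h⟩

lemma setReal {a : ℕ} {i : NExpr} {e : RExpr} (h : Q (s.setReal a (i.eval s) (e.eval s))) :
    Triple (.setReal a i e) s (i.cost + e.cost + 1) Q := ⟨_, _, .setReal s a i e, le_rfl, h⟩

lemma seq {R : Memory → Prop} (hP : Triple P s B R)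
    (hQ : ∀ s', Frame P s s' → R s' → Triple P' s' B' Q) :
    Triple (.seq P P') s (B + B') Q := by
  obtain ⟨t, s', h1, h2, h3⟩ := hP
  obtain ⟨t', s'', h4, h5, h6⟩ := hQ s' h1.frame h3
  exact ⟨t + t', s'', .seq h1 h4, add_le_add h2 h5, h6⟩

lemma ite {b : Test} (h1 : b.holds s → Triple P s B Q) (h2 : ¬ b.holds s → Triple P' s B Q) :
    Triple (.ite b P P') s (b.cost + B) Q := by
  by_cases hb : b.holds s
  · obtain ⟨t, s', h3, h4, h5⟩ := h1 hb
    exact ⟨_, s', .iteTrue hb h3, by omega, h5⟩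
  · obtain ⟨t, s', h3, h4, h5⟩ := h2 hb
    exact ⟨_, s', .iteFalse hb h3, by omega, h5⟩

/-- A loop with invariant `Inv` that runs exactly `N` times, with costs that may depend on the
iteration. -/
lemma loop {b : Test} {Inv : ℕ → Memory → Prop} {c : ℕ → ℕ} (N : ℕ) :
    ∀ k s, Inv k s →
    (∀ i s, k ≤ i → i < k + N → Inv i s → b.holds s ∧ Triple P s (c i) (Inv (i + 1))) →
    (∀ s, Inv (k + N) s → ¬ b.holds s) →
    Triple (.loop b P) s ((∑ i ∈ range N, (b.cost + c (k + i))) + b.cost) (Inv (k + N)) := by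
  induction N with
  | zero => intro k s h0 _ hend; exact ⟨_, s, .loopEnd (hend s h0), by simp, h0⟩
  | succ N ih =>
    intro k s h0 hstep hend
    obtain ⟨hb, t, s', h1, h2, h3⟩ := hstep k s le_rfl (by omega) h0
    have hk : k + 1 + N = k + (N + 1) := by omega
    obtain ⟨t', s'', h4, h5, h6⟩ := ih (k + 1) s' h3 (fun i s hi hi' => hstep i s (by omega)
      (by omega)) (by rwa [hk])
    refine ⟨_, s'', .loopStep hb h1 h4, ?_, hk ▸ h6⟩
    rw [sum_range_succ', add_zero]
    rw [sum_congr rfl fun i _ => by rw [add_comm i 1, ← add_assoc k 1 i]]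
    omega

/-- A loop with invariant `Inv` that runs at most `N` times. -/
lemma loopWhile {b : Test} {Inv : ℕ → Memory → Prop} {c N : ℕ}
    (hstep : ∀ i s, Inv i s → b.holds s → i < N ∧ Triple P s c (Inv (i + 1))) :
    ∀ d k s, N ≤ k + d → Inv k s →
    Triple (.loop b P) s (d * (b.cost + c) + b.cost) fun s' => ∃ i, Inv i s' ∧ ¬ b.holds s' := by
  intro d
  induction d with
  | zero =>
    intro k s hk h
    have hb : ¬ b.holds s := fun hb => by have := (hstep k s h hb).1; omega
    exact ⟨_, s, .loopEnd hb, by simp, k, h, hb⟩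
  | succ d ih =>
    intro k s hk h
    by_cases hb : b.holds s
    · obtain ⟨-, t, s', h1, h2, h3⟩ := hstep k s h hb
      obtain ⟨t', s'', h4, h5, h6⟩ := ih (k + 1) s' (by omega) h3
      exact ⟨_, s'', .loopStep hb h1 h4, by rw [add_mul]; omega, h6⟩
    · exact ⟨_, s, .loopEnd hb, by omega, k, h, hb⟩

end Triple

/-- The scalar variable `a`, kept in the first cell of array `a`. -/
abbrev NExpr.var (a : ℕ) : NExpr := .get a (.const 0)

/-- The real scalar variable `a`, kept in the first cell of array `a`. -/
abbrev RExpr.var (a : ℕ) : RExpr := .get a (.const 0)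

/-- Assignment to the scalar variable `a`. -/
abbrev Prog.setVar (a : ℕ) (e : NExpr) : Prog := .setNat a (.const 0) e

/-- Assignment to the real scalar variable `a`. -/
abbrev Prog.setRVar (a : ℕ) (e : RExpr) : Prog := .setReal a (.const 0) e

/-- `for a := 0 to e - 1 do P`. -/
def Prog.forTo (a : ℕ) (e : NExpr) (P : Prog) : Prog :=
  .seq (.setVar a (.const 0))
    (.loop (.natLt (.var a) e) (.seq P (.setVar a (.add (.var a) (.const 1)))))

/-- The bound `e` is evaluated anew at each test, hence the hypothesis on all memories in the frame.
The invariant is required after the increment of the counter. Test and increment cost `e.cost + 9`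
per round; initialization and the final failing test cost `e.cost + 6`. -/
lemma Triple.forTo {a N : ℕ} {e : NExpr} {P : Prog} {s₀ : Memory} {c : ℕ → ℕ}
    {Inv : ℕ → Memory → Prop} (ha : a ∉ P.natMods)
    (he : ∀ s, Frame (.forTo a e P) s₀ s → e.eval s = N)
    (h0 : Inv 0 (s₀.setNat a 0 0))
    (hstep : ∀ i s, i < N → Frame (.forTo a e P) s₀ s → s.nat a 0 = i → Inv i s →
      Triple P s (c i) fun s' => Inv (i + 1) (s'.setNat a 0 (i + 1))) :
    Triple (.forTo a e P) s₀ ((∑ i ∈ range N, (c i + (e.cost + 9))) + (e.cost + 6)) (Inv N) := by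
  have hfr : ∀ s' v, Frame (.forTo a e P) s' (s'.setNat a 0 v) := fun s' v =>
    ⟨fun b hb => by
      have : b ≠ a := by rintro rfl; exact hb (by simp [Prog.forTo, Prog.natMods])
      simp [Memory.setNat, this], fun _ _ => rfl⟩
  have hloop := Triple.loop (P := .seq P (.setVar a (.add (.var a) (.const 1))))
    (b := .natLt (.var a) e) (c := fun i => c i + 6)
    (Inv := fun i s => Frame (.forTo a e P) s₀ s ∧ s.nat a 0 = i ∧ Inv i s) N 0
    (s₀.setNat a 0 0) ⟨hfr _ _, by simp, h0⟩
    (fun i s _ hi ⟨h1, h2, h3⟩ => by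
      refine ⟨?_, ?_⟩
      · change s.nat a 0 < e.eval s
        rw [h2, he s h1]; omega
      · refine Triple.seq (hstep i s (by omega) h1 h2 h3) fun s' hs' hI =>
          Triple.setNat ?_
        have hi' : s'.nat a 0 = i := by rw [hs'.nat a ha, h2]
        simp only [NExpr.eval, hi']
        refine ⟨(h1.trans (hs'.mono ?_ ?_)).trans (hfr _ _), by simp, hI⟩
        · intro b hb; simp [Prog.forTo, Prog.natMods, hb]
        · intro b hb; simp [Prog.forTo, Prog.realMods, hb])
    (fun s ⟨h1, h2, _⟩ => by
      change ¬ s.nat a 0 < e.eval s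
      rw [h2, he s h1]; omega)
  refine (Triple.seq (B := 3) (Triple.setNat (Q := fun s' => s' = s₀.setNat a 0 0) rfl)
    fun s' _ hs' => hs' ▸ hloop).mono ?_ fun s' _ h => ?_
  · simp only [Test.cost, NExpr.cost, zero_add]
    have : ∀ i ∈ range N, (1 + 1 + e.cost + 1 + (c i + 6)) = c i + (e.cost + 9) :=
      fun i _ => by omega
    rw [sum_congr rfl this]
    omega
  · have := h.2.2
    rwa [zero_add] at this

lemma Triple.forTo_const {a N : ℕ} {e : NExpr} {P : Prog} {s₀ : Memory} {c : ℕ}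
    {Inv : ℕ → Memory → Prop} (ha : a ∉ P.natMods)
    (he : ∀ s, Frame (.forTo a e P) s₀ s → e.eval s = N)
    (h0 : Inv 0 (s₀.setNat a 0 0))
    (hstep : ∀ i s, i < N → Frame (.forTo a e P) s₀ s → s.nat a 0 = i → Inv i s →
      Triple P s c fun s' => Inv (i + 1) (s'.setNat a 0 (i + 1))) :
    Triple (.forTo a e P) s₀ (N * (c + (e.cost + 9)) + (e.cost + 6)) (Inv N) :=
  (Triple.forTo ha he h0 hstep).mono (by simp) fun _ _ h => h

/-- Programs without loops. -/
def Prog.flat : Prog → Bool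
  | .skip => true
  | .setNat _ _ _ => true
  | .setReal _ _ _ => true
  | .seq P Q => P.flat && Q.flat
  | .ite _ P Q => P.flat && Q.flat
  | .loop _ _ => false

/-- An upper bound for the cost of a program without loops. -/
def Prog.flatCost : Prog → ℕ
  | .skip => 1
  | .setNat _ i e => i.cost + e.cost + 1
  | .setReal _ i e => i.cost + e.cost + 1
  | .seq P Q => P.flatCost + Q.flatCost
  | .ite b P Q => b.cost + (P.flatCost + Q.flatCost)
  | .loop _ _ => 0

/-- The weakest precondition of `Q` for a program without loops. -/
def Prog.wp : Prog → (Memory → Prop) → Memory → Prop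
  | .skip, Q, s => Q s
  | .setNat a i e, Q, s => Q (s.setNat a (i.eval s) (e.eval s))
  | .setReal a i e, Q, s => Q (s.setReal a (i.eval s) (e.eval s))
  | .seq P P', Q, s => P.wp (P'.wp Q) s
  | .ite b P P', Q, s => (b.holds s → P.wp Q s) ∧ (¬ b.holds s → P'.wp Q s)
  | .loop _ _, _, _ => False

lemma Triple.of_wp {P : Prog} (hP : P.flat = true) :
    ∀ {s : Memory} {Q : Memory → Prop}, P.wp Q s → Triple P s P.flatCost Q := by
  induction P with
  | skip => exact fun h => Triple.skip h
  | setNat a i e => exact fun h => Triple.setNat h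
  | setReal a i e => exact fun h => Triple.setReal h
  | seq P Q ihP ihQ =>
    simp only [Prog.flat, Bool.and_eq_true] at hP
    exact fun h => Triple.seq (ihP hP.1 h) fun s' _ h => ihQ hP.2 h
  | ite b P Q ihP ihQ =>
    simp only [Prog.flat, Bool.and_eq_true] at hP
    exact fun h => Triple.ite
      (fun hb => (ihP hP.1 (h.1 hb)).mono (by omega) fun s' _ h => h)
      fun hb => (ihQ hP.2 (h.2 hb)).mono (by omega) fun s' _ h => h
  | loop b P _ => simp [Prog.flat] at hP

lemma Triple.flat {P : Prog} {s : Memory} {B : ℕ} {Q : Memory → Prop} (hP : P.flat = true)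
    (hB : P.flatCost ≤ B) (h : P.wp Q s) : Triple P s B Q :=
  (Triple.of_wp hP h).mono hB fun _ _ h' => h'

end Semantics

/-! ### Programs for residuals and covariances. -/

section Programs

open Prog

/-- The number of observed nodes. -/
abbrev nExpr : NExpr := .get 0 (.const 0)

/-- The number of samples. -/
abbrev mExpr : NExpr := .get 0 (.const 1)

/-- The node whose neighborhood is learned. -/
abbrev uExpr : NExpr := .get 0 (.const 2)

/-- The class of the current sample. -/
abbrev classExpr : NExpr := .get 2 (.var 10)

/-- The spin at the current position in the array of samples. -/
abbrev spinExpr : RExpr := .get 1 (.var 11)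

/-- Move the position in the array of samples to the next sample. -/
abbrev nextSample : Prog := .setVar 11 (.add (.var 11) nExpr)

/-- One step of `refineProg`: compute the key `2 * class + bit` of the current sample, and look up
the new class of this key; a new key gets the (positive) number of the sample as its class. -/
def refineBody : Prog :=
  .seq (.setVar 13 (.add classExpr classExpr)) <|
  .seq (.ite (.realLt (.const 0) spinExpr) (.setVar 13 (.add (.var 13) (.const 1))) .skip) <|
  .seq (.ite (.natEq (.get 3 (.var 13)) (.const 0))
    (.setNat 3 (.var 13) (.add (.var 10) (.const 1))) .skip) <|
  .seq (.setNat 2 (.var 10) (.get 3 (.var 13))) nextSample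

/-- Refine the partition of the samples into classes by the value of the spin `i` (variable
`12`). -/
def refineProg : Prog :=
  .seq (.forTo 10 (.add (.add mExpr mExpr) (.const 2)) (.setNat 3 (.var 10) (.const 0))) <|
  .seq (.setVar 11 (.var 12)) (.forTo 10 mExpr refineBody)

/-- Partition the samples by the values of the spins in `S`. -/
def classesProg : Prog :=
  .seq (.forTo 10 mExpr (.setNat 2 (.var 10) (.const 0)))
    (.forTo 12 nExpr (.ite (.natEq (.get 1 (.var 12)) (.const 1)) refineProg .skip))

/-- One step of the computation of the class sizes and of the class sums of the spin `u`. -/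
def sumsBody : Prog :=
  .seq (.setReal 2 classExpr (.add (.get 2 classExpr) spinExpr)) <|
  .seq (.setReal 3 classExpr (.add (.get 3 classExpr) (.const 1))) nextSample

/-- Compute the class sizes and the class sums of the spin `u`. -/
def sumsProg : Prog :=
  .seq (.forTo 10 (.add mExpr (.const 1))
    (.seq (.setReal 2 (.var 10) (.const 0)) (.setReal 3 (.var 10) (.const 0)))) <|
  .seq (.setVar 11 uExpr) (.forTo 10 mExpr sumsBody)

/-- One step of the computation of the residuals. -/
def residualBody : Prog :=
  .seq (.setReal 4 (.var 10) (.sub spinExpr (.div (.get 2 classExpr) (.get 3 classExpr))))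
    nextSample

/-- Compute the residuals of the spin `u` after regression on the spins in `S`. -/
def residualProg : Prog :=
  .seq classesProg <| .seq sumsProg <| .seq (.setVar 11 uExpr) (.forTo 10 mExpr residualBody)

/-- One step of the computation of a covariance. -/
def covBody : Prog :=
  .seq (.setRVar 10 (.add (.var 10) (.mul spinExpr (.get 4 (.var 10))))) nextSample

/-- Compute `M` times the average conditional covariance of `u` and `v` (variable `16`). -/
def covProg : Prog :=
  .seq (.setRVar 10 (.const 0)) <| .seq (.setVar 11 (.var 16)) (.forTo 10 mExpr covBody)

end Programs

/-! ### Correctness of the inner product and of one refinement step. -/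

section Specifications

variable {n M : ℕ} {X : Fin M → Config n} {τ : ℝ} {u : Fin n} {s s' : Memory}

/-- The memory still contains the input. -/
structure IsInput (X : Fin M → Config n) (τ : ℝ) (u : Fin n) (s : Memory) : Prop where
  nodes : s.nat 0 0 = n
  samples : s.nat 0 1 = M
  node : s.nat 0 2 = u
  threshold : s.real 0 0 = τ
  spins : ∀ (k : Fin M) (i : Fin n), s.real 1 (k * n + i) = spin (X k i)

lemma IsInput.frame {P : Prog} (h : IsInput X τ u s) (hf : Frame P s s')
    (h0 : 0 ∉ P.natMods := by decide) (h1 : 0 ∉ P.realMods := by decide)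
    (h2 : 1 ∉ P.realMods := by decide) : IsInput X τ u s' where
  nodes := by rw [hf.nat 0 h0, h.nodes]
  samples := by rw [hf.nat 0 h0, h.samples]
  node := by rw [hf.nat 0 h0, h.node]
  threshold := by rw [hf.real 0 h1, h.threshold]
  spins k i := by rw [hf.real 1 h2, h.spins]

lemma isInput_inputMemory (X : Fin M → Config n) (τ : ℝ) (u : Fin n) :
    IsInput X τ u (inputMemory X τ u) where
  nodes := by simp [inputMemory]
  samples := by simp [inputMemory]
  node := by simp [inputMemory]
  threshold := by simp [inputMemory]
  spins k i := by
    have h : (k * n + i : ℕ) < M * n := by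
      have := (finProdFinEquiv (k, i)).2
      rw [finProdFinEquiv_apply_val] at this
      simp only at this
      linarith [mul_comm n (k : ℕ)]
    have h' : (⟨k * n + i, h⟩ : Fin (M * n)) = finProdFinEquiv (k, i) := by
      ext
      rw [finProdFinEquiv_apply_val]
      simp only
      ring
    simp only [inputMemory, one_ne_zero, if_false, if_true, h, dif_pos, h',
      Equiv.symm_apply_apply]

/-- The machine cannot multiply natural numbers, so the position `k * n + v` is carried along in
variable `11` and advanced by `n`. -/
lemma covProg_spec (hM : 0 < M) (hin : IsInput X τ u s) {v : Fin n} (hv : s.nat 16 0 = v) :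
    Triple covProg s (100 * M) fun s' =>
      s'.real 10 0 = ∑ k : Fin M, spin (X k v) * s.real 4 k := by
  refine (Triple.seq (Triple.flat rfl le_rfl (Q := fun s' => s'.real 10 0 = 0)
    (by simp [Prog.wp, RExpr.eval, NExpr.eval])) fun s₁ f₁ h₁ =>
    Triple.seq (Triple.flat rfl le_rfl (Q := fun s' => s'.nat 11 0 = v) ?_) fun s₂ f₂ h₂ =>
    Triple.forTo_const (N := M) (c := covBody.flatCost) (Inv := fun j t => t.nat 11 0 = j * n + v ∧
      t.real 10 0 = ∑ k ∈ range j, s.real 1 (k * n + v) * s.real 4 k) (by decide)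
      (fun t ht => ?_) ?_ fun j t hj ft hjt ⟨h4, h5⟩ => Triple.flat rfl le_rfl ?_).mono ?_ ?_
  · simp [Prog.wp, NExpr.eval, f₁.nat 16 (by decide), hv]
  · exact (((hin.frame f₁).frame f₂).frame ht).samples
  · have : s₂.real 10 0 = 0 := by rw [f₂.real 10 (by decide), h₁]
    simp [h₂, this]
  · have hi := (((hin.frame f₁).frame f₂).frame ft).nodes
    have e1 : t.real 1 = s.real 1 := by
      rw [ft.real 1 (by decide), f₂.real 1 (by decide), f₁.real 1 (by decide)]
    have e4 : t.real 4 = s.real 4 := by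
      rw [ft.real 4 (by decide), f₂.real 4 (by decide), f₁.real 4 (by decide)]
    simp [Prog.wp, covBody, NExpr.eval, RExpr.eval, h4, h5, hjt, hi, e1, e4, sum_range_succ]
    ring
  · simp [covBody, Prog.flatCost, NExpr.cost, RExpr.cost]
    omega
  · rintro s₃ - ⟨-, h⟩
    rw [h, Finset.sum_range]
    exact sum_congr rfl fun k _ => by rw [hin.spins]

/-- The key of the sample `k` in the refinement of the classes by the spin `i`. -/
noncomputable def sampleKey (s : Memory) (n i k : ℕ) : ℕ :=
  open Classical in s.nat 2 k + s.nat 2 k + if 0 < s.real 1 (k * n + i) then 1 else 0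

/-- The new class of a key is one plus the index of the first sample with that key, so classes stay
at most `M` and keys below `2M + 2`. Clearing the lookup table thus costs only `O(M)`, and the entry
`0` is free to mean "not seen yet". -/
lemma refineProg_spec (hM : 0 < M) (hin : IsInput X τ u s) {i : ℕ} (hi : s.nat 12 0 = i)
    (hcls : ∀ k < M, s.nat 2 k ≤ M) :
    Triple refineProg s (200 * M) fun s' => (∀ k < M, s'.nat 2 k ≤ M) ∧
      ∀ k < M, ∀ l < M, s'.nat 2 k = s'.nat 2 l ↔ sampleKey s n i k = sampleKey s n i l := by
  refine (Triple.seq (R := fun s' => ∀ c < M + M + 2, s'.nat 3 c = 0)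
    (Triple.forTo_const (N := M + M + 2) (c := 4) (Inv := fun j t => ∀ c < j, t.nat 3 c = 0)
      (by decide) (fun t ht => ?_) (by simp) fun j t hj ft hjt h => Triple.flat rfl (by decide) ?_)
    fun s₁ f₁ h₁ =>
    Triple.seq (Triple.flat rfl le_rfl (Q := fun s' => s'.nat 11 0 = i) ?_) fun s₂ f₂ h₂ =>
    -- The last clause makes classes injective on keys: a nonzero entry names a sample that has this
    -- very key. The second clause keeps the old classes of samples not yet visited.
    Triple.forTo_const (N := M) (c := refineBody.flatCost) (Inv := fun j t =>
      t.nat 11 0 = j * n + i ∧ (∀ k, j ≤ k → t.nat 2 k = s.nat 2 k) ∧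
      (∀ k < j, t.nat 2 k = t.nat 3 (sampleKey s n i k) ∧ t.nat 2 k ≠ 0) ∧
      ∀ c < M + M + 2, t.nat 3 c ≠ 0 → t.nat 3 c ≤ j ∧ sampleKey s n i (t.nat 3 c - 1) = c)
      (by decide) (fun t ht => ?_) ?_ fun j t hj ft hjt ⟨h4, h5, h6, h7⟩ =>
        ?_).mono ?_ ?_
  · have := (hin.frame ht).samples
    simp [NExpr.eval, this]
  · intro c hc
    simp only [NExpr.eval, hjt, Memory.setNat_nat]
    by_cases hcj : c = j
    · simp [hcj]
    · simp [hcj, h c (by omega)]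
  · simp [Prog.wp, NExpr.eval, f₁.nat 12 (by decide), hi]
  · exact (((hin.frame f₁).frame f₂).frame ht).samples
  · have e2 : s₂.nat 2 = s.nat 2 := by rw [f₂.nat 2 (by decide), f₁.nat 2 (by decide)]
    have e3 : s₂.nat 3 = s₁.nat 3 := by rw [f₂.nat 3 (by decide)]
    refine ⟨by simp [h₂], by simp [e2], by simp, fun c hc h => ?_⟩
    simp [e3, h₁ c hc] at h
  · have hn := (((hin.frame f₁).frame f₂).frame ft).nodes
    have e1 : t.real 1 = s.real 1 := by
      rw [ft.real 1 (by decide), f₂.real 1 (by decide), f₁.real 1 (by decide)]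
    have hkj : t.nat 2 j + t.nat 2 j +
        (open Classical in if 0 < t.real 1 (t.nat 11 0) then 1 else 0)
        = sampleKey s n i j := by
      rw [h5 j le_rfl, h4, e1, sampleKey]
    have hkl : ∀ k < M, sampleKey s n i k < M + M + 2 := fun k hk => by
      have := hcls k hk
      unfold sampleKey
      split_ifs <;> omega
    set K := sampleKey s n i j with hK
    refine (Triple.flat rfl le_rfl (Q := fun t' => t'.nat 11 0 = t.nat 11 0 + n ∧
      (∀ c, t'.nat 3 c = if c = K ∧ t.nat 3 K = 0 then j + 1 else t.nat 3 c) ∧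
      ∀ k, t'.nat 2 k = if k = j then t'.nat 3 K else t.nat 2 k) ?_).mono le_rfl ?_
    · rw [← hkj]
      simp only [refineBody, Prog.wp, Test.holds, NExpr.eval, RExpr.eval, hjt, Rat.cast_zero,
        Memory.setNat_real, Memory.setNat_nat]
      by_cases hb : 0 < t.real 1 (t.nat 11 0)
      · by_cases hD : t.nat 3 (t.nat 2 j + t.nat 2 j + 1) = 0 <;> simp [hb, hD, hn]
      · by_cases hD : t.nat 3 (t.nat 2 j + t.nat 2 j) = 0 <;> simp [hb, hD, hn]
    rintro t' - ⟨a11, a3, a2⟩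
    have b2 : (t'.setNat 10 0 (j + 1)).nat 2 = t'.nat 2 := by funext k; simp
    have b3 : (t'.setNat 10 0 (j + 1)).nat 3 = t'.nat 3 := by funext k; simp
    have b11 : (t'.setNat 10 0 (j + 1)).nat 11 = t'.nat 11 := by funext k; simp
    rw [b2, b3, b11]
    have hK0 : t'.nat 3 K ≠ 0 := by
      rw [a3]; split_ifs with h
      · omega
      · exact fun h' => h ⟨rfl, h'⟩
    refine ⟨by rw [a11, h4]; ring, fun k hk => ?_, fun k hk => ?_, fun c hc h => ?_⟩
    · rw [a2, if_neg (by omega), h5 k (by omega)]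
    · by_cases hkj' : k = j
      · rw [a2, if_pos hkj', hkj']
        exact ⟨rfl, hK0⟩
      · obtain ⟨h8, h9⟩ := h6 k (by omega)
        rw [a2, if_neg hkj', a3, if_neg]
        · exact ⟨h8, h9⟩
        · rintro ⟨h10, h11⟩
          rw [← h10, ← h8] at h11
          exact h9 h11
    · rw [a3] at h ⊢
      split_ifs with hcK
      · exact ⟨le_rfl, by rw [hcK.1]; rfl⟩
      · rw [if_neg hcK] at h
        obtain ⟨h8, h9⟩ := h7 c hc h
        exact ⟨by omega, h9⟩
  · simp [refineBody, Prog.flatCost, NExpr.cost, RExpr.cost, Test.cost]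
    omega
  · rintro s₃ - ⟨-, -, h6, h7⟩
    have hkl : ∀ k < M, sampleKey s n i k < M + M + 2 := fun k hk => by
      have := hcls k hk
      unfold sampleKey
      split_ifs <;> omega
    have hkey : ∀ k < M, s₃.nat 2 k ≤ M ∧
        sampleKey s n i (s₃.nat 2 k - 1) = sampleKey s n i k := fun k hk => by
      obtain ⟨h8, h9⟩ := h6 k hk
      rw [h8] at h9 ⊢
      exact h7 _ (hkl k hk) h9
    refine ⟨fun k hk => (hkey k hk).1, fun k hk l hl => ⟨fun h => ?_, fun h => ?_⟩⟩
    · rw [← (hkey k hk).2, ← (hkey l hl).2, h]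
    · rw [(h6 k hk).1, (h6 l hl).1, h]

end Specifications

/-! ### Correctness of the class partition, class sums and residuals. -/

section ResidualSpec

variable {n M : ℕ} {X : Fin M → Config n} {τ : ℝ} {u : Fin n} {s s' : Memory}
  {S : Finset (Fin n)}

lemma spin_pos_iff (b : Bool) : 0 < spin b ↔ b = true := by cases b <;> simp [spin]

lemma sampleKey_eq_iff (hin : IsInput X τ u s) (i : Fin n) (k l : Fin M) :
    sampleKey s n i k = sampleKey s n i l ↔ s.nat 2 k = s.nat 2 l ∧ X k i = X l i := by
  unfold sampleKey
  rw [hin.spins, hin.spins]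
  cases hk : X k i <;> cases hl : X l i <;> simp [spin_pos_iff] <;> omega

/-- Invariant: after `j` rounds two samples share a class exactly if they agree on the elements of
`S` below `j`. Each of the `n` rounds costs `O(M)`. -/
lemma classesProg_spec (hM : 0 < M) (hin : IsInput X τ u s) (hS : s.Outputs S) :
    Triple classesProg s (300 * (M * n)) fun s' => (∀ k < M, s'.nat 2 k ≤ M) ∧
      ∀ k l : Fin M, s'.nat 2 k = s'.nat 2 l ↔ AgreeOn S (X k) (X l) := by
  refine (Triple.seq (R := fun s' => ∀ k < M, s'.nat 2 k = 0)
    (Triple.forTo_const (N := M) (c := 4) (Inv := fun j t => ∀ k < j, t.nat 2 k = 0)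
      (by decide) (fun t ht => ?_) (by simp)
      fun j t hj ft hjt h => Triple.flat rfl (by decide) ?_) fun s₁ f₁ h₁ =>
    Triple.forTo_const (N := n) (c := 5 + 200 * M) (Inv := fun j t => (∀ k < M, t.nat 2 k ≤ M) ∧
      ∀ k l : Fin M, t.nat 2 k = t.nat 2 l ↔ ∀ i ∈ S, (i : ℕ) < j → X l i = X k i)
      (by decide) (fun t ht => ?_) ⟨?_, ?_⟩
      fun j t hj ft hjt ⟨h2, h3⟩ => (Triple.ite (B := 200 * M) (fun hb => ?_) fun hb => ?_).mono
        le_rfl fun _ _ h => h).mono ?_ ?_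
  · exact (hin.frame ht).samples
  · intro c hc
    simp only [NExpr.eval, hjt, Memory.setNat_nat]
    by_cases hcj : c = j
    · simp [hcj]
    · simp [hcj, h c (by omega)]
  · exact ((hin.frame f₁).frame ht).nodes
  · intro k hk; simp [h₁ k hk]
  · intro k l; simp [h₁ k k.2, h₁ l l.2]
  all_goals try
    have hin' := (hin.frame f₁).frame ft
    have e1 : t.nat 1 j = if (⟨j, hj⟩ : Fin n) ∈ S then 1 else 0 := by
      rw [ft.nat 1 (by decide), f₁.nat 1 (by decide)]
      exact hS ⟨j, hj⟩
    have hb' : t.nat 1 j = 1 ↔ (⟨j, hj⟩ : Fin n) ∈ S := by rw [e1]; split_ifs <;> simp [*]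
    simp only [Test.holds, NExpr.eval, hjt, hb'] at hb
    have hsucc : ∀ k l : Fin M, (∀ i ∈ S, (i : ℕ) < j + 1 → X l i = X k i) ↔
        (∀ i ∈ S, (i : ℕ) < j → X l i = X k i) ∧
          ((⟨j, hj⟩ : Fin n) ∈ S → X l ⟨j, hj⟩ = X k ⟨j, hj⟩) := fun k l =>
      ⟨fun h => ⟨fun i hi hij => h i hi (by omega), fun hi => h _ hi (by simp)⟩,
        fun h i hi hij => by
          rcases Nat.lt_succ_iff_lt_or_eq.1 hij with h' | h'
          · exact h.1 i hi h'
          · have hij' : i = ⟨j, hj⟩ := Fin.ext h'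
            rw [hij'] at hi ⊢
            exact h.2 hi⟩
  · refine (refineProg_spec hM hin' hjt h2).mono le_rfl fun t' _ ⟨h4, h5⟩ => ⟨?_, ?_⟩
    · intro k hk; simpa using h4 k hk
    · intro k l
      rw [hsucc]
      have h6 := (h5 k k.2 l l.2).trans (sampleKey_eq_iff hin' ⟨j, hj⟩ k l)
      simp [h6, h3, hb, eq_comm]
  · refine (Triple.skip ?_).mono (B := 1) (by omega) fun _ _ h => h
    refine ⟨fun k hk => by simpa using h2 k hk, fun k l => ?_⟩
    rw [hsucc]
    simp [h3, hb]
  · have h1 : 1 ≤ n := u.pos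
    have h2 : M ≤ M * n := Nat.le_mul_of_pos_right M h1
    have h3 : n ≤ M * n := Nat.le_mul_of_pos_left n hM
    simp only [NExpr.cost]
    nlinarith
  · rintro s₂ - ⟨h2, h3⟩
    refine ⟨h2, fun k l => (h3 k l).trans ⟨fun h i hi => h i hi i.2, fun h i hi _ => h i hi⟩⟩

/-- Class numbers range over `0, …, M` (the class `0` occurs when `S` is empty), hence the `M + 1`
cells. -/
lemma sumsProg_spec (hM : 0 < M) (hin : IsInput X τ u s) :
    Triple sumsProg s (300 * M) fun s' => ∀ c ≤ M,
      s'.real 2 c = (∑ l ∈ range M, if s.nat 2 l = c then s.real 1 (l * n + u) else 0) ∧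
      s'.real 3 c = ∑ l ∈ range M, if s.nat 2 l = c then 1 else 0 := by
  refine (Triple.seq (R := fun s' => ∀ c < M + 1, s'.real 2 c = 0 ∧ s'.real 3 c = 0)
    (Triple.forTo_const (N := M + 1) (c := 8)
      (Inv := fun j t => ∀ c < j, t.real 2 c = 0 ∧ t.real 3 c = 0)
      (by decide) (fun t ht => ?_) (by simp)
      fun j t hj ft hjt h => Triple.flat rfl (by decide) ?_) fun s₁ f₁ h₁ =>
    Triple.seq (Triple.flat rfl le_rfl (Q := fun s' => s'.nat 11 0 = u) ?_) fun s₂ f₂ h₂ =>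
    Triple.forTo_const (N := M) (c := sumsBody.flatCost) (Inv := fun j t =>
      t.nat 11 0 = j * n + u ∧ ∀ c ≤ M,
      t.real 2 c = (∑ l ∈ range j, if s.nat 2 l = c then s.real 1 (l * n + u) else 0) ∧
      t.real 3 c = ∑ l ∈ range j, if s.nat 2 l = c then 1 else 0) (by decide)
      (fun t ht => ?_) ?_
      fun j t hj ft hjt ⟨h4, h5⟩ => Triple.flat rfl le_rfl ?_).mono ?_ ?_
  · have := (hin.frame ht).samples
    simp [NExpr.eval, this]
  · intro c hc
    simp only [RExpr.eval, NExpr.eval, hjt, Memory.setNat_real, Memory.setReal_real,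
      Memory.setReal_nat]
    by_cases hcj : c = j
    · simp [hcj]
    · simp [hcj, h c (by omega)]
  · simp [Prog.wp, NExpr.eval, (hin.frame f₁).node]
  · exact (((hin.frame f₁).frame f₂).frame ht).samples
  · refine ⟨by simp [h₂], fun c hc => ?_⟩
    have := h₁ c (by omega)
    simp [f₂.real 2 (by decide), f₂.real 3 (by decide), this]
  · have hn := (((hin.frame f₁).frame f₂).frame ft).nodes
    have e1 : t.real 1 = s.real 1 := by
      rw [ft.real 1 (by decide), f₂.real 1 (by decide), f₁.real 1 (by decide)]
    have e2 : t.nat 2 = s.nat 2 := by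
      rw [ft.nat 2 (by decide), f₂.nat 2 (by decide), f₁.nat 2 (by decide)]
    simp only [sumsBody, Prog.wp, RExpr.eval, NExpr.eval, hjt, Memory.setNat_real,
      Memory.setReal_real, Memory.setReal_nat, Memory.setNat_nat, e1, e2, hn, h4]
    refine ⟨by simp; ring, fun c hc => ?_⟩
    have h6 := h5 c hc
    rw [sum_range_succ, sum_range_succ]
    by_cases hcj : c = s.nat 2 j
    · subst hcj
      simp [h6]
    · simp [hcj, Ne.symm hcj, h6]
  · simp [sumsBody, Prog.flatCost, NExpr.cost, RExpr.cost]
    omega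
  · rintro s₃ - ⟨-, h⟩
    exact h

/-- The program computes the residuals of `X_u` with respect to the current set `S`. -/
lemma residualProg_spec (hM : 0 < M) (hin : IsInput X τ u s) (hS : s.Outputs S) :
    Triple residualProg s (1000 * (M * n)) fun s' =>
      ∀ k : Fin M, s'.real 4 k = residual X u S k := by
  refine (Triple.seq (classesProg_spec hM hin hS) fun s₁ f₁ ⟨h₁, h₁'⟩ =>
    Triple.seq (sumsProg_spec hM (hin.frame f₁)) fun s₂ f₂ h₂ =>
    Triple.seq (Triple.flat rfl le_rfl (Q := fun s' => s'.nat 11 0 = u) ?_) fun s₃ f₃ h₃ =>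
    Triple.forTo_const (N := M) (c := residualBody.flatCost) (Inv := fun j t =>
      t.nat 11 0 = j * n + u ∧ ∀ k : Fin M, k < j → t.real 4 k = residual X u S k) (by decide)
      (fun t ht => ?_) ?_
      fun j t hj ft hjt ⟨h4, h5⟩ => Triple.flat rfl le_rfl ?_).mono ?_ ?_
  · simp [Prog.wp, NExpr.eval, ((hin.frame f₁).frame f₂).node]
  · exact ((((hin.frame f₁).frame f₂).frame f₃).frame ht).samples
  · simp [h₃]
  · have hin' := (((hin.frame f₁).frame f₂).frame f₃).frame ft
    have hin₁ := hin.frame f₁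
    have e2 : t.nat 2 = s₁.nat 2 := by
      rw [ft.nat 2 (by decide), f₃.nat 2 (by decide), f₂.nat 2 (by decide)]
    have er2 : t.real 2 = s₂.real 2 := by rw [ft.real 2 (by decide), f₃.real 2 (by decide)]
    have er3 : t.real 3 = s₂.real 3 := by rw [ft.real 3 (by decide), f₃.real 3 (by decide)]
    have hx := hin'.spins ⟨j, hj⟩ u
    simp only at hx
    simp only [residualBody, Prog.wp, RExpr.eval, NExpr.eval, hjt, Memory.setNat_real,
      Memory.setReal_real, Memory.setReal_nat, Memory.setNat_nat, e2, er2, er3, hin'.nodes, h4, hx]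
    refine ⟨by simp; ring, fun k hk => ?_⟩
    by_cases hkj : (k : ℕ) = j
    · obtain rfl : k = ⟨j, hj⟩ := Fin.ext hkj
      obtain ⟨h6, h7⟩ := h₂ (s₁.nat 2 j) (h₁ j hj)
      have hag : ∀ l : Fin M, s₁.nat 2 l = s₁.nat 2 j ↔ AgreeOn S (X ⟨j, hj⟩) (X l) := fun l =>
        eq_comm.trans (h₁' ⟨j, hj⟩ l)
      rw [Finset.sum_range] at h6 h7
      simp only [hag, hin₁.spins, ← sum_filter] at h6 h7
      simp [h6, h7, residual]
    · simp [hkj, h5 k (by omega)]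
  · have h1 : 1 ≤ n := u.pos
    have h2 : M ≤ M * n := Nat.le_mul_of_pos_right M h1
    simp [residualBody, Prog.flatCost, NExpr.cost, RExpr.cost]
    nlinarith
  · rintro s₄ - ⟨-, h⟩ k
    exact h k k.2

/-- The program computes `M` times the empirical average conditional covariance. -/
lemma covProg_spec_empCovAvg (hM : 0 < M) (hin : IsInput X τ u s) {v : Fin n}
    (hv : s.nat 16 0 = v) (hr : ∀ k : Fin M, s.real 4 k = residual X u S k) :
    Triple covProg s (100 * M) fun s' => s'.real 10 0 = empCovAvg X u v S * M :=
  (covProg_spec hM hin hv).mono le_rfl fun s' _ h => by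
    rw [h, empCovAvg_eq_residual hM]
    exact sum_congr rfl fun k _ => by rw [hr]

end ResidualSpec

/-! ### The complete program, its correctness and running time. -/

section LearnProgram

open Prog

/-- Compute `τ * M` (real variable `11`). -/
def thresholdProg : Prog :=
  .seq (.setRVar 11 (.const 0)) (.forTo 10 mExpr (.setRVar 11 (.add (.var 11) (.var 0))))

/-- Update the current maximizer (variable `15`) and the current maximum (real variable `12`). -/
def updateMax : Prog :=
  .ite (.realLt (.var 10) (.var 12)) .skip
    (.seq (.setVar 15 (.var 16)) (.seq (.setRVar 12 (.var 10)) (.setVar 14 (.const 1))))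

/-- One step of `selectProg`. -/
def selectBody : Prog :=
  .ite (.natEq (.get 1 (.var 16)) (.const 0))
    (.ite (.natEq (.var 16) uExpr) .skip (.seq covProg updateMax)) .skip

/-- Find a maximizer of the average conditional covariance, if the maximum is at least `τ`; the
flag (variable `14`) tells whether this is the case. -/
def selectProg : Prog :=
  .seq (.setVar 14 (.const 0)) (.seq (.setRVar 12 (.var 11)) (.forTo 16 nExpr selectBody))

/-- One step of the greedy phase. -/
def growBody : Prog :=
  .seq residualProg (.seq selectProg
    (.ite (.natEq (.var 14) (.const 1)) (.setNat 1 (.var 15) (.const 1)) .skip))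

/-- The greedy phase. -/
def growProg : Prog :=
  .seq (.setVar 14 (.const 1)) (.loop (.natEq (.var 14) (.const 1)) growBody)

/-- Put a node that has been removed back if its average conditional covariance is at least
`τ`. -/
def restoreProg : Prog :=
  .ite (.realLt (.var 10) (.var 11)) .skip (.setNat 1 (.var 16) (.const 1))

/-- One step of the pruning phase. -/
def pruneBody : Prog :=
  .ite (.natEq (.get 1 (.var 16)) (.const 1))
    (.seq (.setNat 1 (.var 16) (.const 0)) (.seq residualProg (.seq covProg restoreProg))) .skip

/-- The pruning phase. -/
def pruneProg : Prog := .forTo 16 nExpr pruneBody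

/-- The greedy algorithm. -/
def learnProg : Prog := .seq thresholdProg (.seq growProg pruneProg)

variable {n M : ℕ} {X : Fin M → Config n} {τ : ℝ} {u : Fin n} {s : Memory}
  {S : Finset (Fin n)}

/-- Covariances are computed without the factor `1 / M`, so the threshold is scaled by `M`. Natural
numbers cannot be converted to reals, whence the repeated addition. -/
lemma thresholdProg_spec (hin : IsInput X τ u s) :
    Triple thresholdProg s (25 * M + 20) fun s' => s'.real 11 0 = τ * M := by
  refine (Triple.seq (Triple.flat rfl le_rfl (Q := fun s' => s'.real 11 0 = 0) ?_) fun s₁ f₁ h₁ =>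
    Triple.forTo_const (N := M) (c := 7) (Inv := fun j t => t.real 11 0 = τ * j)
      (by decide) (fun t ht => ?_) ?_ fun j t hj ft hjt h => Triple.flat rfl (by decide) ?_).mono
      ?_ fun _ _ h => h
  · simp [Prog.wp, RExpr.eval, NExpr.eval]
  · exact ((hin.frame f₁).frame ht).samples
  · simp [h₁]
  · have := ((hin.frame f₁).frame ft).threshold
    simp [Prog.wp, RExpr.eval, NExpr.eval, h, this]
    ring
  · simp [Prog.flatCost, NExpr.cost, RExpr.cost]
    omega

lemma updateMax_flatCost : updateMax.flatCost = 17 := rfl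

/-- Either no candidate reaches the threshold and the flag is `0`, or the flag is `1` and
variable `15` holds a maximizer. -/
def Selected (X : Fin M → Config n) (τ : ℝ) (u : Fin n) (S : Finset (Fin n)) (s : Memory) :
    Prop :=
  (s.nat 14 0 = 0 ∧ ∀ v, v ∉ insert u S → empCovAvg X u v S < τ) ∨
    (s.nat 14 0 = 1 ∧ ∃ i : Fin n, s.nat 15 0 = i ∧ IsArgmax X u S i ∧ τ ≤ empCovAvg X u i S)

/-- The running maximum starts at `τ * M` and is replaced also in case of equality. Hence the flag
is raised exactly when some candidate reaches `τ`, and the stored node is then a maximizer. -/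
lemma selectProg_spec (hM : 0 < M) (hin : IsInput X τ u s) (hS : s.Outputs S)
    (hthr : s.real 11 0 = τ * M) (hr : ∀ k : Fin M, s.real 4 k = residual X u S k) :
    Triple selectProg s (200 * (M * n)) (Selected X τ u S) := by
  have hMr : (0 : ℝ) < M := by exact_mod_cast hM
  refine (Triple.seq (Triple.flat rfl le_rfl (Q := fun s' => s'.nat 14 0 = 0) ?_)
    fun s₁ f₁ h₁ => Triple.seq
      (Triple.flat rfl le_rfl (Q := fun s' => s'.real 12 0 = τ * M) ?_) fun s₂ f₂ h₂ =>
    Triple.forTo_const (N := n) (c := 5 + (5 + (100 * M + 17))) (Inv := fun j t =>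
      (t.nat 14 0 = 0 ∧ t.real 12 0 = τ * M ∧
        ∀ v : Fin n, v < j → v ∉ insert u S → empCovAvg X u v S < τ) ∨
      (t.nat 14 0 = 1 ∧ ∃ i : Fin n, t.nat 15 0 = i ∧ i ∉ insert u S ∧
        τ ≤ empCovAvg X u i S ∧ t.real 12 0 = empCovAvg X u i S * M ∧
        ∀ v : Fin n, v < j → v ∉ insert u S → empCovAvg X u v S ≤ empCovAvg X u i S))
      (by decide) (fun t ht => ?_) ?_
      fun j t hj ft hjt h => (Triple.ite (B := 5 + (100 * M + 17)) (fun hb => (Triple.ite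
        (B := 100 * M + 17) (fun hb' => ?_) fun hb' => ?_).mono le_rfl fun _ _ h => h)
        fun hb => ?_).mono le_rfl fun _ _ h => h).mono ?_ ?_
  · simp [Prog.wp, NExpr.eval]
  · simp [Prog.wp, RExpr.eval, NExpr.eval, f₁.real 11 (by decide), hthr]
  · exact (((hin.frame f₁).frame f₂).frame ht).nodes
  · left
    refine ⟨?_, by simp [h₂], by simp⟩
    simp [f₂.nat 14 (by decide), h₁]
  all_goals try
    have hin' := ((hin.frame f₁).frame f₂).frame ft
    obtain ⟨v, rfl⟩ : ∃ v : Fin n, (v : ℕ) = j := ⟨⟨j, hj⟩, rfl⟩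
    have e1 : t.nat 1 v = if v ∈ S then 1 else 0 := by
      rw [ft.nat 1 (by decide), f₂.nat 1 (by decide), f₁.nat 1 (by decide)]
      exact hS v
    have hb1 : t.nat 1 v = 0 ↔ v ∉ S := by rw [e1]; split_ifs with h <;> simp [h]
    have hstep : ∀ w : Fin n, (w : ℕ) < v + 1 → (w : ℕ) < v ∨ w = v := fun w hw =>
      (Nat.lt_succ_iff_lt_or_eq.1 hw).imp id fun h => Fin.ext h
    simp only [Test.holds, NExpr.eval, hjt, hb1] at hb
  · simp only [Test.holds, NExpr.eval, hjt, hin'.node] at hb'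
    have hvu : v ∈ insert u S := mem_insert.2 (Or.inl (Fin.ext hb'))
    refine (Triple.skip ?_).mono (B := 1) (by omega) fun _ _ h => h
    refine h.imp (fun ⟨h3, h4, h5⟩ => ⟨by simpa using h3, by simpa using h4, fun w hw hw' => ?_⟩)
      fun ⟨h3, i, h4, h5, h6, h7, h8⟩ =>
        ⟨by simpa using h3, i, by simpa using h4, h5, h6, by simpa using h7, fun w hw hw' => ?_⟩
    · rcases hstep w hw with h | rfl
      exacts [h5 w h hw', absurd hvu hw']
    · rcases hstep w hw with h | rfl
      exacts [h8 w h hw', absurd hvu hw']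
  · simp only [Test.holds, NExpr.eval, hjt, hin'.node] at hb'
    have hvu : v ∉ insert u S := by
      simp only [mem_insert, not_or]
      exact ⟨fun h => hb' (congrArg Fin.val h), hb⟩
    have hr' : ∀ k : Fin M, t.real 4 k = residual X u S k := fun k => by
      rw [ft.real 4 (by decide), f₂.real 4 (by decide), f₁.real 4 (by decide), hr]
    refine Triple.seq (covProg_spec_empCovAvg hM hin' (v := v) hjt hr') fun t' f' h' =>
      Triple.flat rfl updateMax_flatCost.le ?_
    have hjt' : t'.nat 16 0 = v := by rw [f'.nat 16 (by decide), hjt]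
    rw [← f'.nat 14 (by decide), ← f'.nat 15 (by decide), ← f'.real 12 (by decide)] at h
    constructor
    · intro hlt
      simp only [Test.holds, RExpr.eval, NExpr.eval, h'] at hlt
      refine h.imp (fun ⟨h3, h4, h5⟩ => ⟨by simpa using h3, by simpa using h4, fun w hw hw' => ?_⟩)
        fun ⟨h3, i, h4, h5, h6, h7, h8⟩ =>
          ⟨by simpa using h3, i, by simpa using h4, h5, h6, by simpa using h7, fun w hw hw' => ?_⟩
      · rcases hstep w hw with h | rfl
        · exact h5 w h hw'
        · rw [h4] at hlt
          exact lt_of_mul_lt_mul_right hlt hMr.le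
      · rcases hstep w hw with h | rfl
        · exact h8 w h hw'
        · rw [h7] at hlt
          exact (lt_of_mul_lt_mul_right hlt hMr.le).le
    · intro hlt
      simp only [Test.holds, RExpr.eval, NExpr.eval, h', not_lt] at hlt
      refine Or.inr ⟨by simp [NExpr.eval], v, by simp [NExpr.eval, hjt'], hvu, ?_⟩
      rcases h with ⟨h3, h4, h5⟩ | ⟨h3, i, h4, h5, h6, h7, h8⟩
      · rw [h4] at hlt
        have hle := le_of_mul_le_mul_right hlt hMr
        refine ⟨hle, by simp [RExpr.eval, NExpr.eval, h'], fun w hw hw' => ?_⟩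
        rcases hstep w hw with h | rfl
        exacts [(h5 w h hw').le.trans hle, le_rfl]
      · rw [h7] at hlt
        have hle := le_of_mul_le_mul_right hlt hMr
        refine ⟨h6.trans hle, by simp [RExpr.eval, NExpr.eval, h'], fun w hw hw' => ?_⟩
        rcases hstep w hw with h | rfl
        exacts [(h8 w h hw').trans hle, le_rfl]
  · have hvu : v ∈ insert u S := mem_insert_of_mem (not_not.1 hb)
    refine (Triple.skip ?_).mono (B := 1) (by omega) fun _ _ h => h
    refine h.imp (fun ⟨h3, h4, h5⟩ => ⟨by simpa using h3, by simpa using h4, fun w hw hw' => ?_⟩)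
      fun ⟨h3, i, h4, h5, h6, h7, h8⟩ =>
        ⟨by simpa using h3, i, by simpa using h4, h5, h6, by simpa using h7, fun w hw hw' => ?_⟩
    · rcases hstep w hw with h | rfl
      exacts [h5 w h hw', absurd hvu hw']
    · rcases hstep w hw with h | rfl
      exacts [h8 w h hw', absurd hvu hw']
  · have h1 : 1 ≤ n := u.pos
    have h2 : M ≤ M * n := Nat.le_mul_of_pos_right M h1
    have h3 : n ≤ M * n := Nat.le_mul_of_pos_left n hM
    simp only [Prog.flatCost, NExpr.cost, RExpr.cost]
    nlinarith
  · rintro s₃ - (⟨h3, -, h5⟩ | ⟨h3, i, h4, h5, h6, -, h8⟩)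
    · exact Or.inl ⟨h3, fun v hv => h5 v v.2 hv⟩
    · exact Or.inr ⟨h3, i, h4, ⟨h5, fun v hv => h8 v v.2 hv⟩, h6⟩

lemma Memory.Outputs.insert (h : s.Outputs S) (i : Fin n) :
    (s.setNat 1 i 1).Outputs (insert i S) := fun j => by
  by_cases hj : j = i
  · simp [hj]
  · simp [hj, Fin.val_inj, h j]

lemma Memory.Outputs.erase (h : s.Outputs S) (i : Fin n) :
    (s.setNat 1 i 0).Outputs (S.erase i) := fun j => by
  by_cases hj : j = i
  · simp [hj]
  · simp [hj, Fin.val_inj, h j]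

/-- The loop invariant of the greedy phase: the flag tells whether the phase goes on. -/
def GrowInv (X : Fin M → Config n) (τ : ℝ) (u : Fin n) (i : ℕ) (s : Memory) : Prop :=
  IsInput X τ u s ∧ s.real 11 0 = τ * M ∧ ∃ S, s.Outputs S ∧
    ((s.nat 14 0 = 1 ∧ #S = i ∧ #S * τ ^ 2 ≤ explained (empirical X) u S ∧
      ∀ S', Grows X τ u S S' → Grows X τ u ∅ S') ∨ (s.nat 14 0 = 0 ∧ Grows X τ u ∅ S))

/-- `Grows` is built from its end, so the invariant records the past as a continuation: every
completion from the current set is a completion from `∅`. -/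
lemma growBody_spec (hM : 0 < M) (hτ : 0 ≤ τ) {i : ℕ} (h : GrowInv X τ u i s)
    (hflag : s.nat 14 0 = 1) :
    Triple growBody s (1300 * (M * n)) (GrowInv X τ u (i + 1)) := by
  obtain ⟨hin, hthr, S, hS, h⟩ := h
  obtain ⟨-, hcard, hexp, hgrow⟩ := h.resolve_right fun h' => by omega
  refine (Triple.seq (residualProg_spec hM hin hS) fun s₁ f₁ h₁ =>
    Triple.seq (selectProg_spec hM (hin.frame f₁) (S := S) ?_ ?_ h₁) fun s₂ f₂ h₂ =>
    Triple.flat rfl le_rfl ?_).mono ?_ fun _ _ h => h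
  · exact fun j => by rw [f₁.nat 1 (by decide)]; exact hS j
  · rw [f₁.real 11 (by decide), hthr]
  · have hin' := (hin.frame f₁).frame f₂
    have hthr' : s₂.real 11 0 = τ * M := by
      rw [f₂.real 11 (by decide), f₁.real 11 (by decide), hthr]
    have hS' : s₂.Outputs S := fun j => by
      rw [f₂.nat 1 (by decide), f₁.nat 1 (by decide)]; exact hS j
    rcases h₂ with ⟨h3, h4⟩ | ⟨h3, v, h4, h5, h6⟩
    · refine ⟨fun hb => ?_, fun _ => ⟨hin', hthr', S, hS', Or.inr ⟨h3, hgrow S (.finish S h4)⟩⟩⟩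
      simp [Test.holds, NExpr.eval, h3] at hb
    · refine ⟨fun _ => ?_, fun hb => ?_⟩
      · simp only [Prog.wp, NExpr.eval, h4]
        refine ⟨⟨?_, ?_, ?_, ?_, ?_⟩, ?_, _, hS'.insert v, Or.inl ⟨by simp [h3], ?_,
          card_insert_mul_sq_le_explained hM hτ hexp h6,
          fun S' h' => hgrow S' (.step S S' v h5 h6 h')⟩⟩
        · simp [hin'.nodes]
        · simp [hin'.samples]
        · simp [hin'.node]
        · simp [hin'.threshold]
        · simpa using hin'.spins
        · simpa using hthr'
        · rw [card_insert_of_notMem fun h => h5.1 (mem_insert_of_mem h), hcard]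
      · simp [Test.holds, NExpr.eval, h3] at hb
  · have h1 : 1 ≤ M * n := Nat.mul_pos hM u.pos
    simp only [Prog.flatCost, Test.cost, NExpr.cost]
    omega

lemma growProg_spec (hM : 0 < M) (hτ : 0 < τ) (hin : IsInput X τ u s)
    (hS : s.Outputs (∅ : Finset (Fin n))) (hthr : s.real 11 0 = τ * M) :
    Triple growProg s ((⌊1 / τ ^ 2⌋₊ + 1) * (1400 * (M * n)) + 10) fun s' =>
      IsInput X τ u s' ∧ s'.real 11 0 = τ * M ∧ ∃ S, s'.Outputs S ∧ Grows X τ u ∅ S := by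
  -- While the flag is `1` the set has `i` elements and `i * τ ^ 2 ≤ 1`; the extra round is the one
  -- that finds no candidate.
  set N := ⌊1 / τ ^ 2⌋₊ + 1
  have hstep : ∀ i t, GrowInv X τ u i t → (Test.natEq (.var 14) (.const 1)).holds t →
      i < N ∧ Triple growBody t (1300 * (M * n)) (GrowInv X τ u (i + 1)) := by
    intro i t ht hb
    have hflag : t.nat 14 0 = 1 := hb
    refine ⟨?_, growBody_spec hM hτ.le ht hflag⟩
    obtain ⟨-, -, S, -, h⟩ := ht
    obtain ⟨-, hcard, hexp, -⟩ := h.resolve_right fun h' => by omega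
    have h1 := hexp.trans (explained_le_one (empirical_nonneg X) (sum_empirical hM X) u S)
    rw [hcard] at h1
    refine Nat.lt_succ_of_le (Nat.le_floor ?_)
    rwa [le_div_iff₀ (by positivity)]
  have hend : ∀ t, (∃ i, GrowInv X τ u i t ∧ ¬ (Test.natEq (.var 14) (.const 1)).holds t) →
      IsInput X τ u t ∧ t.real 11 0 = τ * M ∧ ∃ S, t.Outputs S ∧ Grows X τ u ∅ S := by
    rintro t ⟨i, ht, hb⟩
    have hflag : ¬ t.nat 14 0 = 1 := hb
    obtain ⟨h1, h2, S, h3, h4⟩ := ht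
    exact ⟨h1, h2, S, h3, (h4.resolve_left fun h' => hflag h'.1).2⟩
  refine (Triple.seq (Triple.flat rfl le_rfl (Q := GrowInv X τ u 0) ?_) fun s₁ f₁ h₁ =>
    (Triple.loopWhile hstep N 0 s₁ (by omega) h₁).mono le_rfl fun t _ h => hend t h).mono
      ?_ fun _ _ h => h
  · simp only [Prog.wp, NExpr.eval]
    refine ⟨⟨?_, ?_, ?_, ?_, ?_⟩, ?_, ∅, fun j => ?_, Or.inl ⟨by simp, rfl, ?_, fun _ h => h⟩⟩
    · simp [hin.nodes]
    · simp [hin.samples]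
    · simp [hin.node]
    · simp [hin.threshold]
    · simpa using hin.spins
    · simpa using hthr
    · simpa using hS j
    · simpa using explained_nonneg (empirical_nonneg X) u ∅
  · have h1 : 1 ≤ M * n := Nat.mul_pos hM u.pos
    simp only [Prog.flatCost, Test.cost, NExpr.cost]
    have : N * (1 + 1 + 1 + 1 + 1300 * (M * n)) ≤ N * (1400 * (M * n)) :=
      Nat.mul_le_mul_left N (by omega)
    omega

open Classical in
/-- The set of nodes after the first `j` tests of the pruning phase. -/
noncomputable def prunedSet (X : Fin M → Config n) (τ : ℝ) (u : Fin n) (S₀ : Finset (Fin n))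
    (j : ℕ) : Finset (Fin n) :=
  ((List.finRange n).take j).foldl (fun S v => if v ∈ S₀ then pruneStep X τ u S v else S) S₀

open Classical in
lemma prunedSet_succ (S₀ : Finset (Fin n)) {j : ℕ} (hj : j < n) :
    prunedSet X τ u S₀ (j + 1) = if (⟨j, hj⟩ : Fin n) ∈ S₀ then
      pruneStep X τ u (prunedSet X τ u S₀ j) ⟨j, hj⟩ else prunedSet X τ u S₀ j := by
  have hj' : j < (List.finRange n).length := by simpa using hj
  rw [prunedSet, List.take_succ_eq_append_getElem hj', List.foldl_append]
  simp [prunedSet]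

/-- A test can remove only the node it is made for, so when the scan reaches `v` the indicator still
tells whether `v` was in `S₀`. -/
lemma mem_prunedSet_of_le (S₀ : Finset (Fin n)) (v : Fin n) :
    ∀ j : ℕ, j ≤ v → (v ∈ prunedSet X τ u S₀ j ↔ v ∈ S₀)
  | 0, _ => by simp [prunedSet]
  | j + 1, hj => by
    have hjn : j < n := by have := v.2; omega
    have hne : v ≠ ⟨j, hjn⟩ := fun h => by
      have := congrArg Fin.val h
      simp only at this
      omega
    rw [prunedSet_succ S₀ hjn, ← mem_prunedSet_of_le S₀ v j (by omega)]
    unfold pruneStep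
    split_ifs <;> simp [hne]

lemma learnRBMNbhd_prunedSet {S₀ : Finset (Fin n)} (h : Grows X τ u ∅ S₀) :
    LearnRBMNbhd X τ u (prunedSet X τ u S₀ n) := by
  classical
  refine ⟨S₀, (List.finRange n).filter fun v => decide (v ∈ S₀), h,
    (List.nodup_finRange n).filter _, by ext; simp, ?_⟩
  rw [List.foldl_filter, prunedSet, List.take_of_length_le (by simp)]
  simp

/-- The node is erased before the residuals are computed, so that they refer to `S.erase v`, and is
restored if the test fails to discard it. -/
lemma pruneBody_spec (hM : 0 < M) (hin : IsInput X τ u s) (hthr : s.real 11 0 = τ * M)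
    (hS : s.Outputs S) {v : Fin n} (hv : s.nat 16 0 = v) (hvS : v ∈ S) :
    Triple pruneBody s (1200 * (M * n)) fun s' => s'.Outputs (pruneStep X τ u S v) := by
  have hMr : (0 : ℝ) < M := by exact_mod_cast hM
  refine (Triple.ite (B := 4 + (1000 * (M * n) + (100 * M + 20))) (fun _ =>
    Triple.seq (B := 4) (Triple.flat rfl le_rfl (Q := fun s' => IsInput X τ u s' ∧
      s'.real 11 0 = τ * M ∧ s'.Outputs (S.erase v) ∧ s'.nat 16 0 = v) ?_)
    fun s₁ f₁ ⟨h1, h2, h3, h4⟩ => Triple.seq (residualProg_spec hM h1 h3) fun s₂ f₂ h₂ =>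
    Triple.seq (covProg_spec_empCovAvg hM (h1.frame f₂) (v := v) ?_ h₂) fun s₃ f₃ h₃ =>
    Triple.flat rfl (by decide) ?_) fun hb => ?_).mono ?_ fun _ _ h => h
  · simp only [Prog.wp, NExpr.eval, hv]
    refine ⟨⟨?_, ?_, ?_, ?_, ?_⟩, ?_, hS.erase v, by simp [hv]⟩
    · simp [hin.nodes]
    · simp [hin.samples]
    · simp [hin.node]
    · simp [hin.threshold]
    · simpa using hin.spins
    · simpa using hthr
  · rw [f₂.nat 16 (by decide), h4]
  · have hthr' : s₃.real 11 0 = τ * M := by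
      rw [f₃.real 11 (by decide), f₂.real 11 (by decide), h2]
    have hS' : s₃.Outputs (S.erase v) := fun j => by
      rw [f₃.nat 1 (by decide), f₂.nat 1 (by decide)]; exact h3 j
    have hv' : s₃.nat 16 0 = v := by rw [f₃.nat 16 (by decide), f₂.nat 16 (by decide), h4]
    refine ⟨fun hb => ?_, fun hb => ?_⟩
    all_goals
      simp only [Test.holds, RExpr.eval, NExpr.eval, h₃, hthr', mul_lt_mul_iff_left₀ hMr] at hb
    · rw [Prog.wp, pruneStep, if_pos hb]
      exact hS'
    · simp only [Prog.wp, NExpr.eval, hv']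
      rw [pruneStep, if_neg hb]
      have := hS'.insert v
      rwa [insert_erase hvS] at this
  · simp [Test.holds, NExpr.eval, hv, hS v, hvS] at hb
  · have h1 : 1 ≤ M * n := Nat.mul_pos hM u.pos
    have h2 : M ≤ M * n := Nat.le_mul_of_pos_right M u.pos
    simp only [Test.cost, NExpr.cost]
    omega

/-- The cost is summed round by round: only the nodes of `S₀` need a covariance, the others are
skipped at constant cost. -/
lemma pruneProg_spec (hM : 0 < M) (hin : IsInput X τ u s) (hthr : s.real 11 0 = τ * M)
    {S₀ : Finset (Fin n)} (hS : s.Outputs S₀) :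
    Triple pruneProg s (#S₀ * (1200 * (M * n)) + 30 * (M * n)) fun s' =>
      s'.Outputs (prunedSet X τ u S₀ n) := by
  classical
  refine (Triple.forTo (N := n)
    (c := fun j => (if j ∈ S₀.map Fin.valEmbedding then 1200 * (M * n) else 0) + 6)
    (Inv := fun j t => t.Outputs (prunedSet X τ u S₀ j)) (by decide) (fun t ht => ?_) ?_
    fun j t hj ft hjt h => ?_).mono ?_ fun _ _ h => h
  · exact (hin.frame ht).nodes
  · intro i
    have h0 : prunedSet X τ u S₀ 0 = S₀ := by simp [prunedSet]
    rw [h0, hS i |>.symm]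
    simp
  · have hin' := hin.frame ft
    have hthr' : t.real 11 0 = τ * M := by rw [ft.real 11 (by decide), hthr]
    have hmem := mem_prunedSet_of_le (X := X) (τ := τ) (u := u) S₀ ⟨j, hj⟩ j le_rfl
    have hmap : j ∈ S₀.map Fin.valEmbedding ↔ (⟨j, hj⟩ : Fin n) ∈ S₀ := by
      simp only [mem_map, Fin.valEmbedding_apply]
      exact ⟨fun ⟨w, hw, hw'⟩ => by subst hw'; exact hw, fun h => ⟨_, h, rfl⟩⟩
    simp only [hmap]
    by_cases hj0 : (⟨j, hj⟩ : Fin n) ∈ S₀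
    · rw [prunedSet_succ S₀ hj, if_pos hj0, if_pos hj0]
      refine (pruneBody_spec hM hin' hthr' h (v := ⟨j, hj⟩) hjt (hmem.2 hj0)).mono (by omega)
        fun t' _ h' i => ?_
      simpa using h' i
    · rw [prunedSet_succ S₀ hj, if_neg hj0, if_neg hj0]
      refine (Triple.ite (B := 1) (fun hb => ?_) fun _ => Triple.skip fun i => ?_).mono
        (by simp [Test.cost, NExpr.cost]) fun _ _ h => h
      · have := h ⟨j, hj⟩
        rw [if_neg (mt hmem.1 hj0)] at this
        simp only [Test.holds, NExpr.eval, hjt] at hb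
        simp only at this
        omega
      · simpa using h i
  · have h1 : 1 ≤ n := u.pos
    have h3 : n ≤ M * n := Nat.le_mul_of_pos_left n hM
    rw [sum_add_distrib, sum_add_distrib, ← sum_filter, sum_const, sum_const, sum_const]
    have hcard : #(range n |>.filter fun j => j ∈ S₀.map Fin.valEmbedding) ≤ #S₀ := by
      rw [← card_map Fin.valEmbedding]
      exact card_le_card fun j hj => (mem_filter.1 hj).2
    have h4 := Nat.mul_le_mul_right (1200 * (M * n)) hcard
    simp only [smul_eq_mul, card_range, NExpr.cost]
    omega

/-- The program computes an output of the greedy algorithm in time `O((1 + 1 / τ²) M n)`. -/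
lemma learnProg_spec (hM : 0 < M) (hτ : 0 < τ) (X : Fin M → Config n) (u : Fin n) :
    Triple learnProg (inputMemory X τ u) ((⌊1 / τ ^ 2⌋₊ + 1) * (3000 * (M * n))) fun s' =>
      ∃ S : Finset (Fin n), s'.Outputs S ∧ LearnRBMNbhd X τ u S := by
  have hin := isInput_inputMemory X τ u
  have h1 : 1 ≤ M * n := Nat.mul_pos hM u.pos
  have h2 : M ≤ M * n := Nat.le_mul_of_pos_right M u.pos
  have hrest : ∀ s₁, Frame thresholdProg (inputMemory X τ u) s₁ → s₁.real 11 0 = τ * M →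
      Triple (.seq growProg pruneProg) s₁
        ((⌊1 / τ ^ 2⌋₊ + 1) * (1400 * (M * n)) + 10 +
          (⌊1 / τ ^ 2⌋₊ * (1200 * (M * n)) + 30 * (M * n)))
        fun s' => ∃ S : Finset (Fin n), s'.Outputs S ∧ LearnRBMNbhd X τ u S := by
    intro s₁ f₁ h₁
    refine Triple.seq (growProg_spec hM hτ (hin.frame f₁) (fun i => ?_) h₁) ?_
    · rw [f₁.nat 1 (by decide)]
      simp [inputMemory]
    · rintro s₂ f₂ ⟨h3, h4, S₀, h5, h6⟩
      refine (pruneProg_spec hM h3 h4 h5).mono ?_ fun s' _ h => ⟨_, h, learnRBMNbhd_prunedSet h6⟩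
      have hcard := (h6.spec hM hτ.le (notMem_empty u)
        (by simpa using explained_nonneg (empirical_nonneg X) u ∅)).2.1
      have : #S₀ ≤ ⌊1 / τ ^ 2⌋₊ := Nat.le_floor (by rwa [le_div_iff₀ (by positivity)])
      have := Nat.mul_le_mul_right (1200 * (M * n)) this
      omega
  refine (Triple.seq (thresholdProg_spec hin) hrest).mono ?_ fun _ _ h => h
  nlinarith [Nat.zero_le (⌊1 / τ ^ 2⌋₊ * (M * n))]

end LearnProgram

end RBMLearn

theorem theorem4p1 :
    -- correctness, with a universal constant `C` in the sample complexity
    (∃ C : ℝ, 0 < C ∧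
      ∀ (n m : ℕ) (R : RBM n m) (α lam : ℝ), 0 < α → R.LocallyConsistent α lam →
        IsCondProbLowerBound R.obsProb (Real.exp (-2 * lam) / 2) ∧
        ∀ (δ : ℝ), IsCondProbLowerBound R.obsProb δ →
        ∀ (ζ τ T : ℝ), 0 < ζ → ζ < 1 →
          τ = α ^ 2 / 2 * Real.exp (-12 * lam) → T = 8 / τ ^ 2 →
        ∀ (M : ℕ),
          C * ((Real.log (1 / ζ) + T * Real.log n)
            * ((2 : ℝ) ^ (2 * T) / (τ ^ 2 * δ ^ (2 * T)))) ≤ M →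
        ∀ (Ω : Type*) [MeasurableSpace Ω] (P : Measure Ω) [IsProbabilityMeasure P]
          (X : Fin M → Ω → Config n),
          (∀ k, Measurable (X k)) → iIndepFun X P →
          (∀ k x, P.real {ω | X k ω = x} = R.obsProb x) →
          1 - ζ ≤ P.real {ω | ∀ (u : Fin n) (S : Finset (Fin n)),
            LearnRBMNbhd (fun k => X k ω) τ u S ↔ ∀ i, i ∈ S ↔ R.IsTwoHop u i}) ∧
    -- running time, with a universal constant `c`
    (∃ (prog : Prog) (c : ℝ), 0 < c ∧
      ∀ (n M : ℕ) (X : Fin M → Config n) (τ : ℝ) (u : Fin n), 0 < M → 0 < τ →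
        ∃ (t : ℕ) (s : Memory) (S : Finset (Fin n)),
          Exec prog (inputMemory X τ u) t s ∧ s.Outputs S ∧ LearnRBMNbhd X τ u S ∧
          (t : ℝ) ≤ c * max 1 (8 / τ ^ 2) * M * n) := by
  refine ⟨⟨512, by norm_num, ?_⟩, learnProg, 6000, by norm_num, ?_⟩
  · intro n m R α lam hα hR
    refine ⟨hR.isCondProbLowerBound, ?_⟩
    intro δ hδ ζ τ T hζ hζ1 hτ hT M hM Ω _ P _ X hX hind hp
    exact hR.le_measureReal_learnRBMNbhd hα hδ hζ hζ1 hτ hT hM P hX hind hp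
  · intro n M X τ u hM hτ
    obtain ⟨t, s, hexec, ht, S, hS, hout⟩ := learnProg_spec hM hτ X u
    refine ⟨t, s, S, hexec, hS, hout, ?_⟩
    -- Both terms of `⌊1 / τ ^ 2⌋₊ + 1` are at most the maximum, which doubles the constant `3000`.
    have h1 : (⌊1 / τ ^ 2⌋₊ : ℝ) ≤ max 1 (8 / τ ^ 2) :=
      (Nat.floor_le (by positivity)).trans (le_max_of_le_right (by gcongr; norm_num))
    have h2 : (1 : ℝ) ≤ max 1 (8 / τ ^ 2) := le_max_left _ _
    calc (t : ℝ) ≤ ((⌊1 / τ ^ 2⌋₊ + 1) * (3000 * (M * n)) : ℕ) := by exact_mod_cast ht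
      _ = (⌊1 / τ ^ 2⌋₊ + 1) * (3000 * (M * n)) := by push_cast; ring
      _ ≤ (max 1 (8 / τ ^ 2) + max 1 (8 / τ ^ 2)) * (3000 * (M * n)) := by gcongr
      _ = 6000 * max 1 (8 / τ ^ 2) * M * n := by ring
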